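/- Let $d\ge 2$ and let $\mathcal P$ be a stacked $(d+1)$-polytope, i.e. a polytope obtained from a $(d+1)$-simplex by finitely many stacking operations; a stacking operation glues a new simplex onto a facet $F$, that is, it replaces a polytope $\mathcal Q$ by $\operatorname{conv}(\mathcal Q\cup\{v\})$ for a point $v$ beyond the facet $F$ and beneath every other facet of $\mathcal Q$. Let $G(\mathcal P)$ be its graph ($1$-skeleton), and suppose that $G(\mathcal P)$ is $d$-ball packable. Here a $d$-ball is a closed ball, the closed exterior of a ball together with $\infty$, or a closed half-space together with $\infty$, in $\hat{\mathbb R}^d=\mathbb R^d\cup\{\infty\}$; two balls are tangent if they have exactly one point in common. A $d$-ball packing is a collection of $d$-balls with pairwise disjoint interiors; it is a packing of a graph $G$ if its tangency graph is isomorphic to $G$, and $G$ is $d$-ball packable if it has such a packing. A Descartes configuration is a $d$-ball packing consisting of $d+2$ pairwise tangent balls. A collection of $d$-balls is Apollonian if it can be built from a Descartes configuration by finitely many steps, each of which introduces, for some $d+1$ pairwise tangent balls of the collection, a new ball tangent to all of them. Then every $d$-ball packing of $G(\mathcal P)$ is Apollonian. Moreover the packing is unique up to Möbius transformations and reflections: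 if $\mathcal S_1,\mathcal S_2$ are $d$-ball packings of $G(\mathcal P)$ and $f_i$ $(i=1,2)$ is an isomorphism from $G(\mathcal P)$ to the tangency graph of $\mathcal S_i$, then there is an element $\varphi$ of the group of transformations of $\hat{\mathbb R}^d$ generated by inversions in spheres and reflections in hyperplanes such that $\varphi(f_1(v))=f_2(v)$ for every vertex $v$ of $\mathcal P$; in particular $\varphi$ maps $\mathcal S_1$ onto $\mathcal S_2$. -/

import Mathlib

open Set
open scoped OnePoint

noncomputable section

namespace Apollonian

/-- Euclidean space `ℝⁿ`. -/
abbrev Eucl (n : ℕ) : Type := EuclideanSpace ℝ (Fin n)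

/-- The extended Euclidean space `ℝᵈ ∪ {∞}`, with the topology of the one-point
compactification. -/
abbrev ExtEucl (d : ℕ) : Type := OnePoint (Eucl d)

/-! ### Balls and ball packings -/

/-- The `d`-balls of the extended space, as sets: closed balls of radius `r > 0`
(curvature `1 / r`), closed exteriors of balls of radius `r > 0` together with `∞`
(curvature `-1 / r`), and closed half-spaces together with `∞` (curvature `0`). -/
def IsBall {d : ℕ} (B : Set (ExtEucl d)) : Prop :=
  (∃ (c : Eucl d) (r : ℝ), 0 < r ∧
    B = (fun x : Eucl d => (x : ExtEucl d)) '' {x | ‖x - c‖ ≤ r}) ∨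
  (∃ (c : Eucl d) (r : ℝ), 0 < r ∧
    B = insert ∞ ((fun x : Eucl d => (x : ExtEucl d)) '' {x | r ≤ ‖x - c‖})) ∨
  (∃ (n : Eucl d) (b : ℝ), ‖n‖ = 1 ∧
    B = insert ∞ ((fun x : Eucl d => (x : ExtEucl d)) '' {x | b ≤ inner ℝ x n}))

/-- Two balls are tangent if their intersection consists of a single point. (A ball always has
more than one point when `d > 0`, so the requirement `A ≠ B` is then automatic.) -/
def Tangent {d : ℕ} (A B : Set (ExtEucl d)) : Prop :=
  A ≠ B ∧ ∃ t, A ∩ B = {t}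

/-- A `d`-ball packing: a collection of `d`-balls with pairwise disjoint interiors. -/
def IsBallPacking {d : ℕ} (S : Set (Set (ExtEucl d))) : Prop :=
  (∀ B ∈ S, IsBall B) ∧ S.PairwiseDisjoint interior

/-- The tangency graph of a collection of balls. -/
def tangencyGraph {d : ℕ} (S : Set (Set (ExtEucl d))) : SimpleGraph S where
  Adj A B := Tangent (A : Set (ExtEucl d)) B
  symm := ⟨fun _ _ h => ⟨h.1.symm, by rw [inter_comm]; exact h.2⟩⟩
  loopless := ⟨fun _ h => h.1 rfl⟩

/-- A Descartes configuration: a `d`-ball packing of `d + 2` pairwise tangent balls. -/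
def IsDescartes {d : ℕ} (S : Set (Set (ExtEucl d))) : Prop :=
  IsBallPacking S ∧ S.encard = d + 2 ∧ S.Pairwise Tangent

/-- A (finite) collection of `d`-balls is Apollonian if it can be built from a Descartes
configuration by repeatedly introducing, for `d + 1` pairwise tangent balls `T` of the
collection, a new ball `B` that is tangent to all of them. The new ball may touch or overlap
other balls of the collection. -/
inductive IsApollonian {d : ℕ} : Set (Set (ExtEucl d)) → Prop
  | descartes (S : Set (Set (ExtEucl d))) : IsDescartes S → IsApollonian S
  | add (S T : Set (Set (ExtEucl d))) (B : Set (ExtEucl d)) :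
      IsApollonian S → T ⊆ S → T.encard = d + 1 → T.Pairwise Tangent →
      IsBall B → B ∉ S → (∀ A ∈ T, Tangent A B) → IsApollonian (insert B S)

/-! ### Möbius transformations and reflections -/

/-- Inversion of the extended space in the sphere with centre `c` and radius `R`;
it exchanges `c` and `∞`. -/
def extInversion {d : ℕ} (c : Eucl d) (R : ℝ) (p : ExtEucl d) : ExtEucl d :=
  open Classical in
  p.elim (c : ExtEucl d) fun x => if x = c then ∞ else (EuclideanGeometry.inversion c R x : Eucl d)

/-- Reflection of the extended space in the hyperplane `{x | ⟪x, n⟫ = b}`, for a unit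
vector `n`; it fixes `∞`. -/
def extReflection {d : ℕ} (n : Eucl d) (b : ℝ) (p : ExtEucl d) : ExtEucl d :=
  p.map fun x => x - (2 * (inner ℝ x n - b)) • n

theorem extInversion_involutive {d : ℕ} (c : Eucl d) {R : ℝ} (hR : 0 < R) :
    Function.Involutive (extInversion c R) := by
  intro p
  induction p using OnePoint.rec with
  | infty => simp [extInversion]
  | coe x =>
    by_cases h : x = c
    · simp [extInversion, h]
    · have h2 : EuclideanGeometry.inversion c R x ≠ c := by
        rw [Ne, EuclideanGeometry.inversion_eq_center hR.ne']
        exact h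
      simp [extInversion, h, h2, EuclideanGeometry.inversion_inversion c hR.ne' x]

theorem extReflection_involutive {d : ℕ} (n : Eucl d) (hn : ‖n‖ = 1) (b : ℝ) :
    Function.Involutive (extReflection n b) := by
  intro p
  induction p using OnePoint.rec with
  | infty => simp [extReflection]
  | coe x =>
    have h : inner ℝ n n = (1 : ℝ) := by rw [real_inner_self_eq_norm_sq, hn]; norm_num
    simp only [extReflection, OnePoint.map_some, inner_sub_left, inner_smul_left, h]
    congr 1
    simp only [conj_trivial]
    module

/-- The group of transformations of `ℝᵈ ∪ {∞}` generated by all inversions in spheres and all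
reflections in hyperplanes: the Möbius transformations, orientation-reversing ones included. -/
def mobiusGroup (d : ℕ) : Subgroup (Equiv.Perm (ExtEucl d)) :=
  Subgroup.closure
    ({φ | ∃ (c : Eucl d) (R : ℝ) (hR : 0 < R), φ = (extInversion_involutive c hR).toPerm} ∪
     {φ | ∃ (n : Eucl d) (b : ℝ) (hn : ‖n‖ = 1), φ = (extReflection_involutive n hn b).toPerm})

/-! ### Stacked polytopes and their graphs -/

/-- The graph (1-skeleton) of a convex polytope `P`: its vertices are the extreme points of `P`,
and two of them are adjacent if the segment between them is a face of `P` (all faces of a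
polytope are exposed). -/
def polytopeGraph {n : ℕ} (P : Set (Eucl n)) : SimpleGraph (P.extremePoints ℝ) where
  Adj x y := x ≠ y ∧ IsExposed ℝ P (segment ℝ (x : Eucl n) y)
  symm := ⟨fun _ _ h => ⟨h.1.symm, by rw [segment_symm]; exact h.2⟩⟩
  loopless := ⟨fun _ h => h.1 rfl⟩

/-- `F` is a facet of the full-dimensional polytope `P ⊆ ℝⁿ`: a face of dimension `n - 1`. -/
def IsFacet {n : ℕ} (P F : Set (Eucl n)) : Prop :=
  F.Nonempty ∧ IsExposed ℝ P F ∧ Module.finrank ℝ (vectorSpan ℝ F) + 1 = n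

/-- The point `v` lies beyond the facet `F` of `P`: the supporting hyperplane of `P` at `F`
strictly separates `v` from the interior of `P`. -/
def IsBeyond {n : ℕ} (P F : Set (Eucl n)) (v : Eucl n) : Prop :=
  ∃ l : StrongDual ℝ (Eucl n), F = l.toExposed P ∧ ∀ x ∈ F, l x < l v

/-- The point `v` lies beneath the facet `F` of `P`: it is strictly on the same side of the
supporting hyperplane of `P` at `F` as the interior of `P`. -/
def IsBeneath {n : ℕ} (P F : Set (Eucl n)) (v : Eucl n) : Prop :=
  ∃ l : StrongDual ℝ (Eucl n), F = l.toExposed P ∧ ∀ x ∈ F, l v < l x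

/-- Stacked `n`-polytopes, realized in `ℝⁿ`: they are built from an `n`-simplex by stacking
operations. Stacking glues the simplex `conv (F ∪ {v})` onto a facet `F` of `P`, so that the
result is again a convex polytope with the new vertex `v` and, apart from `F`, all the facets
of `P`: the point `v` is beyond `F` and beneath every other facet, and the result is
`conv (P ∪ {v})`. -/
inductive IsStackedPolytope {n : ℕ} : Set (Eucl n) → Prop
  | simplex (p : Fin (n + 1) → Eucl n) : AffineIndependent ℝ p →
      IsStackedPolytope (convexHull ℝ (range p))
  | stack (P F : Set (Eucl n)) (v : Eucl n) : IsStackedPolytope P → IsFacet P F →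
      IsBeyond P F v → (∀ G, IsFacet P G → G ≠ F → IsBeneath P G v) →
      IsStackedPolytope (convexHull ℝ (insert v P))

end Apollonian

end

open Apollonian

/-!
Balls of the extended space `ℝᵈ ∪ {∞}` are modelled by unit vectors of a Lorentz space of
signature `(d + 1, 1)`: a point `p` is a null vector `nullVec p`, and the ball of the unit vector
`v` is `ball v = {p | 0 ≤ ⟪v, nullVec p⟫}`. Tangent balls have product `-1`, and their vectors add up to a
positive multiple of the null vector of the tangency point (`exists_add_eq_of_tangent`).
The Lorentz reflection in a unit vector acts on balls as an inversion in a sphere or a reflection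
in a hyperplane (`exists_lifts_refl`). Hence the geometry of packings is linear algebra with the
Gram matrix `2I - J`:

* Two Descartes configurations are congruent (`exists_lifts_of_tangentFamily`). The sums of their
  vectors are timelike, with equal squares and in the same half of the light cone, so one reflection
  maps one sum to the other; afterwards all differences of corresponding vectors are orthogonal
  to a timelike vector, hence spacelike or zero, and can be removed by reflections one at a time.
* For `d ≥ 2` at most two balls are tangent to `d + 1` given pairwise tangent balls
  (`IsTangentFamily.eq_of_ne_of_ne`), because the vectors of the latter span a hyperplane on which
  the form is nondegenerate.

The combinatorial input about a stacked polytope `P` of dimension at least `3` is collected in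
`IsCliquePolytope`: the vertices of each facet form a clique, and some further vertex is joined to
all of them. That stacking preserves this property (`IsCliquePolytope.stack`), creates exactly one
new vertex, joined to the vertices of the facet `F`, and destroys no edge rests on
`IsPolytope.exists_facet`: a functional supporting a polytope at a point can be replaced by that of
a facet through this point, keeping one prescribed inequality. It shows that every edge is in a
facet other than `F`, which stays a face, and that a new facet contains no old vertices outside `F`.

Both claims follow by induction on the stacking operations. The ball of a new vertex is tangent to
the `d + 1` pairwise tangent balls of `F`, so the packing is Apollonian. A congruence between two
packings of the old graph extends to the new vertex: its ball is one of the two balls tangent to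
those of `F`, and the other one belongs to the old vertex joined to `F`.
-/

namespace Apollonian

/-! ### Systems of vectors with Gram matrix `2I - J` -/

section Gram

variable {L : Type*} [AddCommGroup L] [Module ℝ L] (q : LinearMap.BilinForm ℝ L)

/-- The vectors `e i` are unit vectors with pairwise products `-1`: the Gram matrix is `2I - J`.
In the Lorentz model these are the vectors of pairwise tangent balls. -/
def IsTangentFamily {ι : Type*} (e : ι → L) : Prop :=
  (∀ i, q (e i) (e i) = 1) ∧ ∀ i j, i ≠ j → q (e i) (e j) = -1

variable {q}

theorem IsTangentFamily.apply_sum_smul {ι : Type*} [Fintype ι] {e : ι → L}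
    (he : IsTangentFamily q e) (c : ι → ℝ) (i : ι) :
    q (e i) (∑ j, c j • e j) = 2 * c i - ∑ j, c j := by
  classical
  have h : ∀ j, c j * q (e i) (e j) = (if i = j then 2 * c j else 0) - c j := by
    intro j
    split_ifs with hij
    · subst hij; rw [he.1]; ring
    · rw [he.2 i j hij]; ring
  simp only [map_sum, map_smul, smul_eq_mul, h, Finset.sum_sub_distrib, Finset.sum_ite_eq,
    Finset.mem_univ, if_true]

theorem IsTangentFamily.apply_sum {ι : Type*} [Fintype ι] {e : ι → L}
    (he : IsTangentFamily q e) (i : ι) : q (e i) (∑ j, e j) = 2 - Fintype.card ι := by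
  simpa using he.apply_sum_smul (fun _ => 1) i

theorem IsTangentFamily.coeff_eq_zero {ι : Type*} [Fintype ι] {e : ι → L}
    (he : IsTangentFamily q e) (hι : Fintype.card ι ≠ 2) (c : ι → ℝ)
    (h : ∀ i, q (e i) (∑ j, c j • e j) = 0) (i : ι) : c i = 0 := by
  have h1 : ∀ i, 2 * c i = ∑ j, c j := fun i => by
    have := h i
    rw [he.apply_sum_smul] at this
    linarith
  have h2 : 2 * ∑ j, c j = Fintype.card ι * ∑ j, c j := by
    rw [Finset.mul_sum, Finset.sum_congr rfl fun i _ => h1 i]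
    simp
  have h3 : ∑ j, c j = 0 := by
    have h4 : ((Fintype.card ι : ℝ) - 2) * ∑ j, c j = 0 := by linarith
    rcases mul_eq_zero.1 h4 with h5 | h5
    · exact absurd (by exact_mod_cast sub_eq_zero.1 h5) hι
    · exact h5
  linarith [h1 i]

/-- A tangent family with as many members as the dimension is a basis on whose span the form is
nondegenerate. -/
theorem IsTangentFamily.eq_zero_of_orthogonal [FiniteDimensional ℝ L] {ι : Type*} [Fintype ι]
    {e : ι → L} (he : IsTangentFamily q e) (hι : Fintype.card ι ≠ 2)
    (hd : Fintype.card ι = Module.finrank ℝ L) {w : L} (hw : ∀ i, q (e i) w = 0) : w = 0 := by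
  have hli : LinearIndependent ℝ e := by
    rw [Fintype.linearIndependent_iff]
    intro c hc
    exact he.coeff_eq_zero hι c (by simp [hc])
  have hspan := hli.span_eq_top_of_card_eq_finrank' hd
  have hmem : w ∈ Submodule.span ℝ (range e) := hspan ▸ Submodule.mem_top
  obtain ⟨c, rfl⟩ := (Submodule.mem_span_range_iff_exists_fun ℝ).1 hmem
  have := he.coeff_eq_zero hι c hw
  simp [this]

/-- At most two unit vectors have product `-1` with each member of a tangent family of
`dim L - 1` vectors: `x` and its reflection in the orthogonal complement of the family. -/
theorem IsTangentFamily.eq_of_ne_of_ne [FiniteDimensional ℝ L] (hq : q.IsSymm) {ι : Type*}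
    [Fintype ι] {e : ι → L} (he : IsTangentFamily q e) (hι : 2 < Fintype.card ι)
    (hd : Fintype.card ι + 1 = Module.finrank ℝ L) {x y z : L}
    (hx : q x x = 1) (hy : q y y = 1) (hz : q z z = 1)
    (hex : ∀ i, q (e i) x = -1) (hey : ∀ i, q (e i) y = -1) (hez : ∀ i, q (e i) z = -1)
    (hxy : y ≠ x) (hxz : z ≠ x) : y = z := by
  have hsymm : ∀ a b, q a b = q b a := fun a b => by simpa using hq.eq a b
  set N : ℝ := (Fintype.card ι : ℝ) with hN
  have hN2 : 2 < N := by rw [hN]; exact_mod_cast hι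
  have hN0 : N - 2 ≠ 0 := by linarith
  -- `u` is the component of `x` orthogonal to all `e i`
  set u : L := x - (1 / (N - 2)) • ∑ j, e j with hu
  have hue : ∀ i, q (e i) u = 0 := by
    intro i
    rw [hu, map_sub, map_smul, he.apply_sum, hex, smul_eq_mul, ← hN]
    field_simp
    ring
  have hux : q x u ≠ 0 := by
    have h1 : q x (∑ j, e j) = -N := by
      simp [map_sum, hsymm x, hex, hN]
    rw [hu, map_sub, map_smul, h1, hx, smul_eq_mul]
    have : 1 - 1 / (N - 2) * -N = 2 * (N - 1) / (N - 2) := by field_simp; ring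
    rw [this]
    exact div_ne_zero (by linarith) hN0
  have huu : q u u = q x u := by
    have h1 : q u (∑ j, e j) = 0 := by simp [map_sum, hsymm u, hue]
    nth_rewrite 2 [hu]
    rw [map_sub, map_smul, h1, smul_zero, sub_zero, hsymm]
  have hopt : IsTangentFamily q (fun o : Option ι => o.elim x e) := by
    constructor
    · rintro (_ | i)
      exacts [hx, he.1 i]
    · rintro (_ | i) (_ | j) hij
      · exact absurd rfl hij
      · exact (hsymm _ _).trans (hex j)
      · exact hex i
      · exact he.2 i j fun h => hij (h ▸ rfl)
  have key : ∀ y : L, q y y = 1 → (∀ i, q (e i) y = -1) → y ≠ x → y = x + (-2 : ℝ) • u := by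
    intro y hy hey hyx
    obtain ⟨t, ht⟩ : ∃ t : ℝ, y = x + t • u := by
      refine ⟨q x (y - x) / q x u, ?_⟩
      have h0 : (y - x) - (q x (y - x) / q x u) • u = 0 := by
        refine hopt.eq_zero_of_orthogonal (by simp; omega) (by simpa using hd) ?_
        rintro (_ | i)
        · simp only [Option.elim, map_sub, map_smul, smul_eq_mul]
          field_simp
          ring
        · simp [hue, hey, hex]
      rw [← sub_eq_zero.1 h0]
      abel
    have h1 : q y y = 1 + t * (2 + t) * q x u := by
      rw [ht]
      simp only [map_add, map_smul, LinearMap.add_apply, LinearMap.smul_apply, smul_eq_mul, hx,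
        huu, hsymm u x]
      ring
    have h2 : t * (2 + t) = 0 := by
      have : t * (2 + t) * q x u = 0 := by linarith
      exact (mul_eq_zero.1 this).resolve_right hux
    rcases mul_eq_zero.1 h2 with h3 | h3
    · exact absurd (by rw [ht, h3]; simp) hyx
    · rw [ht]
      congr 2
      linarith
  rw [key y hy hey hxy, key z hz hez hxz]

end Gram

section Lorentz

variable {d : ℕ}

/-! ### The Lorentz model of the extended space -/

/-- The Lorentz space of signature `(d + 1, 1)`, with two null coordinates. -/
abbrev Lor (d : ℕ) : Type := Eucl d × ℝ × ℝ

/-- The Lorentz form `⟪a, b⟫ - (κ μ' + κ' μ) / 2`. -/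
noncomputable def lor (d : ℕ) : LinearMap.BilinForm ℝ (Lor d) :=
  LinearMap.mk₂ ℝ (fun v w => inner ℝ v.1 w.1 - (v.2.1 * w.2.2 + v.2.2 * w.2.1) / 2)
    (fun u v w => by simp only [Prod.fst_add, Prod.snd_add, inner_add_left]; ring)
    (fun c v w => by
      simp only [Prod.smul_fst, Prod.smul_snd, real_inner_smul_left, smul_eq_mul]; ring)
    (fun u v w => by simp only [Prod.fst_add, Prod.snd_add, inner_add_right]; ring)
    (fun c v w => by
      simp only [Prod.smul_fst, Prod.smul_snd, real_inner_smul_right, smul_eq_mul]; ring)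

theorem lor_apply (v w : Lor d) :
    lor d v w = inner ℝ v.1 w.1 - (v.2.1 * w.2.2 + v.2.2 * w.2.1) / 2 := rfl

theorem lor_comm (v w : Lor d) : lor d v w = lor d w v := by
  rw [lor_apply, lor_apply, real_inner_comm]; ring

theorem lor_isSymm (d : ℕ) : (lor d).IsSymm := ⟨fun v w => by simpa using lor_comm v w⟩

theorem finrank_lor (d : ℕ) : Module.finrank ℝ (Lor d) = d + 2 := by
  simp [Module.finrank_prod]

/-- The null vector representing a point of the extended space. -/
noncomputable def nullVec (p : ExtEucl d) : Lor d :=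
  p.elim (0, 0, 1) fun x => (x, 1, ‖x‖ ^ 2)

@[simp] theorem nullVec_infty : nullVec (∞ : ExtEucl d) = (0, 0, 1) := rfl

@[simp] theorem nullVec_coe (x : Eucl d) : nullVec (x : ExtEucl d) = (x, 1, ‖x‖ ^ 2) := rfl

theorem lor_nullVec_self (p : ExtEucl d) : lor d (nullVec p) (nullVec p) = 0 := by
  induction p using OnePoint.rec with
  | infty => simp [lor_apply]
  | coe x => simp [lor_apply]

/-- All the null vectors of points lie in the same half of the light cone. -/
theorem lor_nullVec_nonpos (p r : ExtEucl d) : lor d (nullVec p) (nullVec r) ≤ 0 := by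
  induction p using OnePoint.rec with
  | infty => induction r using OnePoint.rec <;> simp [lor_apply]
  | coe x =>
    induction r using OnePoint.rec with
    | infty => simp [lor_apply]
    | coe y =>
      have h := norm_sub_sq_real x y
      have h2 := sq_nonneg ‖x - y‖
      simp only [lor_apply, nullVec_coe]
      linarith

/-- The part of the extended space cut out by a vector of the Lorentz space. -/
def ball (v : Lor d) : Set (ExtEucl d) := {p | 0 ≤ lor d v (nullVec p)}

theorem coe_mem_ball {v : Lor d} {x : Eucl d} :
    (x : ExtEucl d) ∈ ball v ↔ v.2.1 * ‖x‖ ^ 2 + v.2.2 ≤ 2 * inner ℝ v.1 x := by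
  simp only [ball, mem_ofPred_eq, lor_apply, nullVec_coe]
  constructor <;> intro h <;> linarith

theorem infty_mem_ball {v : Lor d} : (∞ : ExtEucl d) ∈ ball v ↔ v.2.1 ≤ 0 := by
  simp only [ball, mem_ofPred_eq, lor_apply, nullVec_infty, inner_zero_right]
  constructor <;> intro h <;> linarith

theorem norm_sub_sq_expand (x c : Eucl d) : ‖x - c‖ ^ 2 = ‖x‖ ^ 2 - 2 * inner ℝ c x + ‖c‖ ^ 2 := by
  rw [norm_sub_sq_real, real_inner_comm]

/-- The unit vector of the sphere with centre `c` and radius `R`. -/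
noncomputable def sphereVec (c : Eucl d) (R : ℝ) : Lor d :=
  (R⁻¹ • c, R⁻¹, (‖c‖ ^ 2 - R ^ 2) / R)

theorem lor_sphereVec (c : Eucl d) {R : ℝ} (hR : 0 < R) :
    lor d (sphereVec c R) (sphereVec c R) = 1 := by
  simp only [sphereVec, lor_apply, real_inner_self_eq_norm_sq, norm_smul, norm_inv,
    Real.norm_of_nonneg hR.le]
  field_simp
  ring

/-- Every `d`-ball is cut out by a unit vector. -/
theorem IsBall.exists_eq_ball {B : Set (ExtEucl d)} (hB : IsBall B) :
    ∃ v : Lor d, lor d v v = 1 ∧ B = ball v := by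
  rcases hB with ⟨c, r, hr, rfl⟩ | ⟨c, r, hr, rfl⟩ | ⟨n, b, hn, rfl⟩
  · refine ⟨sphereVec c r, lor_sphereVec c hr, ?_⟩
    · ext p
      induction p using OnePoint.rec with
      | infty => simp [infty_mem_ball, sphereVec, hr]
      | coe x =>
        rw [coe_mem_ball]
        simp only [mem_image, mem_ofPred_eq, OnePoint.coe_eq_coe, exists_eq_right,
          sphereVec, real_inner_smul_left]
        rw [← abs_of_nonneg (norm_nonneg (x - c)), ← abs_of_pos hr, ← sq_le_sq, abs_of_pos hr,
          norm_sub_sq_expand]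
        field_simp
        constructor <;> intro h <;> linarith
  · refine ⟨-sphereVec c r, by simpa using lor_sphereVec c hr, ?_⟩
    · ext p
      induction p using OnePoint.rec with
      | infty => simp [infty_mem_ball, sphereVec, hr.le]
      | coe x =>
        rw [coe_mem_ball]
        simp only [mem_insert_iff, OnePoint.coe_ne_infty, false_or, mem_image, mem_ofPred_eq,
          OnePoint.coe_eq_coe, exists_eq_right, sphereVec, Prod.neg_mk, real_inner_smul_left, inner_neg_left]
        rw [← abs_of_nonneg (norm_nonneg (x - c)), ← abs_of_pos hr, ← sq_le_sq, abs_of_pos hr,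
          norm_sub_sq_expand]
        have h1 : -r⁻¹ * ‖x‖ ^ 2 + -((‖c‖ ^ 2 - r ^ 2) / r)
          = -((‖x‖ ^ 2 + ‖c‖ ^ 2 - r ^ 2) / r) := by field_simp; ring
        have h2 : 2 * -(r⁻¹ * inner ℝ c x) = -((2 * inner ℝ c x) / r) := by field_simp
        rw [h1, h2, neg_le_neg_iff, div_le_div_iff_of_pos_right hr]
        constructor <;> intro h <;> linarith
  · refine ⟨(n, 0, 2 * b), by simp [lor_apply, hn], ?_⟩
    ext p
    induction p using OnePoint.rec with
    | infty => simp [infty_mem_ball]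
    | coe x =>
      rw [coe_mem_ball]
      simp [real_inner_comm]

/-! ### Lorentz reflections are inversions -/

/-- The reflection of the Lorentz space in the hyperplane orthogonal to the unit vector `u`. -/
noncomputable def refl (u : Lor d) : Lor d →ₗ[ℝ] Lor d :=
  LinearMap.id - (2 : ℝ) • (lor d u).smulRight u

theorem refl_apply (u v : Lor d) : refl u v = v - (2 * lor d u v) • u := by
  simp [refl, smul_smul]

theorem lor_refl (u v w : Lor d) :
    lor d (refl u v) w = lor d v (refl u w) := by
  simp only [refl_apply, map_sub, map_smul, LinearMap.sub_apply, LinearMap.smul_apply,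
    smul_eq_mul, lor_comm v u]
  ring

theorem refl_refl {u : Lor d} (hu : lor d u u = 1) (v : Lor d) : refl u (refl u v) = v := by
  simp only [refl_apply, map_sub, map_smul, hu]
  module

/-- The permutation `φ` of the extended space acts on balls through the Lorentz isometry `Φ`. -/
structure Lifts (φ : Equiv.Perm (ExtEucl d)) (Φ : Lor d →ₗ[ℝ] Lor d) : Prop where
  mem : φ ∈ mobiusGroup d
  isometry : ∀ v w, lor d (Φ v) (Φ w) = lor d v w
  image : ∀ v, φ '' ball v = ball (Φ v)

theorem Lifts.one : Lifts (1 : Equiv.Perm (ExtEucl d)) LinearMap.id :=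
  ⟨one_mem _, fun _ _ => rfl, fun v => by simp⟩

theorem Lifts.mul {φ ψ : Equiv.Perm (ExtEucl d)} {Φ Ψ : Lor d →ₗ[ℝ] Lor d} (hφ : Lifts φ Φ)
    (hψ : Lifts ψ Ψ) : Lifts (φ * ψ) (Φ ∘ₗ Ψ) :=
  ⟨mul_mem hφ.mem hψ.mem, fun v w => by simp [hφ.isometry, hψ.isometry], fun v => by
    rw [Equiv.Perm.coe_mul, image_comp, hψ.image, hφ.image, LinearMap.comp_apply]⟩

/-- An involution that acts on null vectors as the reflection in `u`, up to positive factors,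
lifts to this reflection. -/
theorem Lifts.of_nullVec {φ : Equiv.Perm (ExtEucl d)} (hφ : φ ∈ mobiusGroup d)
    (hinv : Function.Involutive φ) {u : Lor d} (hu : lor d u u = 1)
    (h : ∀ p, ∃ t : ℝ, 0 < t ∧ refl u (nullVec p) = t • nullVec (φ p)) : Lifts φ (refl u) := by
  refine ⟨hφ, fun v w => by rw [lor_refl, refl_refl hu], fun v => ?_⟩
  ext p
  rw [hinv.image_eq_preimage_symm]
  obtain ⟨t, ht, h⟩ := h p
  simp only [ball, mem_preimage, mem_ofPred_eq]
  rw [lor_refl, h, map_smul, smul_eq_mul, mul_nonneg_iff_of_pos_left ht]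

theorem refl_sphereVec_infty (c : Eucl d) {R : ℝ} (hR : 0 < R) :
    refl (sphereVec c R) (nullVec ∞) = (1 / R ^ 2) • nullVec (c : ExtEucl d) := by
  rw [refl_apply]
  simp only [sphereVec, lor_apply, nullVec_infty, nullVec_coe, inner_zero_right]
  ext1
  · simp only [Prod.fst_sub, Prod.smul_fst, smul_smul, zero_sub]
    rw [← neg_smul]
    congr 1
    field_simp
    ring
  · ext1
    · simp
      field_simp
    · simp
      field_simp
      ring

theorem extInversion_lifts (c : Eucl d) {R : ℝ} (hR : 0 < R) :
    Lifts (extInversion_involutive c hR).toPerm (refl (sphereVec c R)) := by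
  refine Lifts.of_nullVec (Subgroup.subset_closure (Or.inl ⟨c, R, hR, rfl⟩))
    (extInversion_involutive c hR) (lor_sphereVec c hR) fun p => ?_
  have hc := refl_sphereVec_infty c hR
  induction p using OnePoint.rec with
  | infty => exact ⟨1 / R ^ 2, by positivity, hc⟩
  | coe x =>
    by_cases hx : x = c
    · subst hx
      refine ⟨R ^ 2, by positivity, ?_⟩
      have h1 : ((extInversion_involutive x hR).toPerm : Equiv.Perm (ExtEucl d)) (x : ExtEucl d) = ∞ := by
        simp [extInversion]
      have h2 := congrArg (refl (sphereVec x R)) hc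
      rw [refl_refl (lor_sphereVec x hR), map_smul] at h2
      rw [h1, h2, smul_smul]
      field_simp
      simp
    · have h1 : ((extInversion_involutive c hR).toPerm : Equiv.Perm (ExtEucl d)) (x : ExtEucl d) =
          (EuclideanGeometry.inversion c R x : Eucl d) := by
        simp [extInversion, hx]
      rw [h1]
      have hxc : 0 < ‖x - c‖ := norm_pos_iff.2 (sub_ne_zero.2 hx)
      have hinv : EuclideanGeometry.inversion c R x = (R / ‖x - c‖) ^ 2 • (x - c) + c := by
        simp [EuclideanGeometry.inversion, dist_eq_norm]
      have hlor : lor d (sphereVec c R) (nullVec (x : ExtEucl d)) =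
          (R ^ 2 - ‖x - c‖ ^ 2) / (2 * R) := by
        rw [norm_sub_sq_expand]
        simp only [sphereVec, lor_apply, nullVec_coe, real_inner_smul_left]
        field_simp
        ring
      refine ⟨‖x - c‖ ^ 2 / R ^ 2, by positivity, ?_⟩
      rw [refl_apply, hlor, hinv]
      simp only [sphereVec, nullVec_coe]
      ext1
      · simp only [Prod.fst_sub, Prod.smul_fst, smul_smul, smul_add]
        have e1 : ‖x - c‖ ^ 2 / R ^ 2 * (R / ‖x - c‖) ^ 2 = 1 := by field_simp
        have e2 : 2 * ((R ^ 2 - ‖x - c‖ ^ 2) / (2 * R)) * R⁻¹ = 1 - ‖x - c‖ ^ 2 / R ^ 2 := by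
          field_simp
        rw [e1, e2]
        module
      · ext1
        · simp
          field_simp
          ring
        · simp only [Prod.snd_sub, Prod.smul_snd, smul_eq_mul]
          rw [norm_add_sq_real, norm_smul, real_inner_smul_left, inner_sub_left,
            real_inner_self_eq_norm_sq, real_inner_comm, Real.norm_of_nonneg (by positivity)]
          have e3 := norm_sub_sq_expand x c
          have e4 : inner ℝ c x = (‖x‖ ^ 2 + ‖c‖ ^ 2 - ‖x - c‖ ^ 2) / 2 := by linarith
          rw [e4]
          field_simp
          ring

theorem extReflection_lifts (n : Eucl d) (hn : ‖n‖ = 1) (b : ℝ) :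
    Lifts (extReflection_involutive n hn b).toPerm (refl (n, 0, 2 * b)) := by
  refine Lifts.of_nullVec (Subgroup.subset_closure (Or.inr ⟨n, b, hn, rfl⟩))
    (extReflection_involutive n hn b) (by simp [lor_apply, hn]) fun p => ⟨1, one_pos, ?_⟩
  rw [one_smul, refl_apply]
  induction p using OnePoint.rec with
  | infty =>
    have h1 : ((extReflection_involutive n hn b).toPerm : Equiv.Perm (ExtEucl d)) ∞ = ∞ := by
      simp [extReflection]
    rw [h1]
    simp [lor_apply]
  | coe x =>
    have h1 : ((extReflection_involutive n hn b).toPerm : Equiv.Perm (ExtEucl d)) (x : ExtEucl d) =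
        ((x - (2 * (inner ℝ x n - b)) • n : Eucl d) : ExtEucl d) := by
      simp [extReflection]
    rw [h1, nullVec_coe, nullVec_coe, norm_sub_sq_real, norm_smul, real_inner_smul_right, hn]
    simp only [lor_apply, Real.norm_eq_abs, mul_pow, sq_abs, real_inner_comm x n]
    ext1
    · simp
    · ext1
      · simp
      · simp
        ring

theorem refl_neg (u : Lor d) : refl (-u) = refl u := by
  refine LinearMap.ext fun v => ?_
  simp [refl_apply]

/-- Every Lorentz reflection in a unit vector comes from an inversion or a reflection. -/
theorem exists_lifts_refl {u : Lor d} (hu : lor d u u = 1) : ∃ φ, Lifts φ (refl u) := by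
  have hpos : ∀ u : Lor d, lor d u u = 1 → 0 < u.2.1 → ∃ φ, Lifts φ (refl u) := by
    rintro ⟨a, k, k'⟩ hu hk
    simp only [lor_apply, real_inner_self_eq_norm_sq] at hu hk
    have h : ((a, k, k') : Lor d) = sphereVec (k⁻¹ • a) k⁻¹ := by
      simp only [sphereVec, inv_inv, smul_smul, mul_inv_cancel₀ hk.ne', one_smul, norm_smul,
        norm_inv, Real.norm_of_nonneg hk.le]
      congr 2
      field_simp
      linarith
    rw [h]
    exact ⟨_, extInversion_lifts _ (inv_pos.2 hk)⟩
  rcases lt_trichotomy u.2.1 0 with h | h | h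
  · rw [← refl_neg]
    exact hpos _ (by simpa using hu) (by simpa using h)
  · obtain ⟨a, k, k'⟩ := u
    simp only [lor_apply, real_inner_self_eq_norm_sq] at hu h
    subst h
    have hn : ‖a‖ = 1 := by
      rw [← sq_eq_sq₀ (norm_nonneg a) zero_le_one]
      linarith
    have := extReflection_lifts a hn (k' / 2)
    rw [mul_div_cancel₀ k' two_ne_zero] at this
    exact ⟨_, this⟩
  · exact hpos u hu h

/-! ### Tangency in the Lorentz model -/

theorem eventually_quadratic {A C : ℝ} (B : ℝ) (hA : 0 < A) :
    ∀ᶠ s : ℝ in Filter.atTop, C ≤ A * s ^ 2 + B * s := by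
  filter_upwards [Filter.eventually_ge_atTop (1 + (|B| + |C|) / A)] with s hs
  have h0 : 0 ≤ (|B| + |C|) / A := by positivity
  have h1 : A + (|B| + |C|) ≤ A * s := by
    have := mul_le_mul_of_nonneg_left hs hA.le
    rwa [mul_add, mul_one, mul_div_cancel₀ _ hA.ne'] at this
  have hs1 : 1 ≤ s := by linarith
  have h2 := neg_abs_le B
  have h3 := le_abs_self C
  have h4 : |C| ≤ A * s + B := by linarith
  have h5 := abs_nonneg C
  nlinarith [mul_le_mul_of_nonneg_left hs1 (h5.trans h4)]

/-- Far out in the direction `a`, a ball whose interior contains `∞`, or a half-space with inner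
normal `n` such that `⟪n, a⟫ > 0`, contains all points. -/
theorem eventually_smul_mem_ball {v : Lor d} {a : Eucl d}
    (h : (v.2.1 < 0 ∧ a ≠ 0) ∨ (v.2.1 = 0 ∧ 0 < inner ℝ v.1 a)) :
    ∀ᶠ s : ℝ in Filter.atTop, ((s • a : Eucl d) : ExtEucl d) ∈ ball v := by
  rcases h with ⟨hv, ha⟩ | ⟨hv, ha⟩
  · have hA : 0 < -v.2.1 * ‖a‖ ^ 2 :=
      mul_pos (neg_pos.2 hv) (pow_pos (norm_pos_iff.2 ha) 2)
    filter_upwards [eventually_quadratic (C := v.2.2) (2 * inner ℝ v.1 a) hA] with s hs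
    rw [coe_mem_ball, norm_smul, real_inner_smul_right, mul_pow, Real.norm_eq_abs, sq_abs]
    linarith
  · filter_upwards [Filter.eventually_ge_atTop (v.2.2 / (2 * inner ℝ v.1 a))] with s hs
    rw [coe_mem_ball, real_inner_smul_right, hv]
    rw [div_le_iff₀ (by linarith)] at hs
    linarith

/-- Balls tangent at infinity are parallel half-spaces. -/
theorem exists_add_eq_of_inter_eq_infty (hd : 0 < d) {v w : Lor d} (hv : lor d v v = 1)
    (hw : lor d w w = 1) (h : ball v ∩ ball w = {∞}) :
    ∃ t : ℝ, 0 < t ∧ v + w = t • nullVec ∞ := by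
  have hinf : (∞ : ExtEucl d) ∈ ball v ∩ ball w := h ▸ mem_singleton _
  have hnot : ∀ x : Eucl d, ¬ ((x : ExtEucl d) ∈ ball v ∧ (x : ExtEucl d) ∈ ball w) := by
    intro x hx
    have : (x : ExtEucl d) ∈ ({∞} : Set (ExtEucl d)) := h ▸ hx
    exact OnePoint.coe_ne_infty x this
  have hk : v.2.1 ≤ 0 := infty_mem_ball.1 hinf.1
  have hl : w.2.1 ≤ 0 := infty_mem_ball.1 hinf.2
  have hdir : ∀ a : Eucl d, ((v.2.1 < 0 ∧ a ≠ 0) ∨ (v.2.1 = 0 ∧ 0 < inner ℝ v.1 a)) →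
      ¬ ((w.2.1 < 0 ∧ a ≠ 0) ∨ (w.2.1 = 0 ∧ 0 < inner ℝ w.1 a)) := by
    intro a h1 h2
    obtain ⟨s, hs⟩ := ((eventually_smul_mem_ball h1).and (eventually_smul_mem_ball h2)).exists
    exact hnot _ hs
  have hunit : ∀ u : Lor d, lor d u u = 1 → u.2.1 = 0 → ‖u.1‖ ^ 2 = 1 := by
    intro u hu h0
    rw [lor_apply, h0, real_inner_self_eq_norm_sq] at hu
    linarith
  have hnz : ∀ u : Lor d, ‖u.1‖ ^ 2 = 1 → u.1 ≠ 0 := by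
    rintro u hu h0
    simp [h0] at hu
  obtain ⟨e, he⟩ : ∃ e : Eucl d, e ≠ 0 := by
    have : Nonempty (Fin d) := ⟨⟨0, hd⟩⟩
    exact exists_ne 0
  have hk0 : v.2.1 = 0 := by
    by_contra hne
    have hneg := lt_of_le_of_ne hk hne
    rcases hl.lt_or_eq with h1 | h1
    · exact hdir e (Or.inl ⟨hneg, he⟩) (Or.inl ⟨h1, he⟩)
    · have := hunit w hw h1
      exact hdir w.1 (Or.inl ⟨hneg, hnz w this⟩)
        (Or.inr ⟨h1, by rw [real_inner_self_eq_norm_sq]; linarith⟩)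
  have hv1 := hunit v hv hk0
  have hl0 : w.2.1 = 0 := by
    by_contra hne
    exact hdir v.1 (Or.inr ⟨hk0, by rw [real_inner_self_eq_norm_sq]; linarith⟩)
      (Or.inl ⟨lt_of_le_of_ne hl hne, hnz v hv1⟩)
  have hw1 := hunit w hw hl0
  have hsum : v.1 + w.1 = 0 := by
    by_contra hne
    have hpos : 0 < ‖v.1 + w.1‖ ^ 2 := pow_pos (norm_pos_iff.2 hne) 2
    rw [norm_add_sq_real] at hpos
    refine hdir (v.1 + w.1) (Or.inr ⟨hk0, ?_⟩) (Or.inr ⟨hl0, ?_⟩)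
    · rw [inner_add_right, real_inner_self_eq_norm_sq]
      linarith
    · rw [inner_add_right, real_inner_self_eq_norm_sq, real_inner_comm]
      linarith
  refine ⟨v.2.2 + w.2.2, ?_, ?_⟩
  · by_contra hle
    refine hnot ((v.2.2 / 2) • v.1) ⟨?_, ?_⟩
    · rw [coe_mem_ball, hk0, real_inner_smul_right, real_inner_self_eq_norm_sq, hv1]
      linarith
    · rw [coe_mem_ball, hl0, real_inner_smul_right, eq_neg_of_add_eq_zero_right hsum,
        inner_neg_left, real_inner_self_eq_norm_sq, hv1]
      linarith
  · ext1
    · simpa using hsum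
    · ext1
      · simp [hk0, hl0]
      · simp

/-- The vectors of two tangent balls add up to a positive multiple of the null vector of the
tangency point. -/
theorem exists_add_eq_of_tangent (hd : 0 < d) {v w : Lor d} (hv : lor d v v = 1)
    (hw : lor d w w = 1) (h : Tangent (ball v) (ball w)) :
    ∃ (t : ℝ) (p : ExtEucl d), 0 < t ∧ v + w = t • nullVec p := by
  obtain ⟨p, hp⟩ := h.2
  induction p using OnePoint.rec with
  | infty =>
    obtain ⟨t, ht, h⟩ := exists_add_eq_of_inter_eq_infty hd hv hw hp
    exact ⟨t, ∞, ht, h⟩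
  | coe c =>
    -- the inversion with centre `c` moves the tangency point to infinity
    have hL := extInversion_lifts c one_pos
    set φ : Equiv.Perm (ExtEucl d) := (extInversion_involutive c one_pos).toPerm with hφ
    set Φ := refl (sphereVec c 1) with hΦ
    have himg : ball (Φ v) ∩ ball (Φ w) = {∞} := by
      rw [← hL.image, ← hL.image, ← image_inter φ.injective, hp, image_singleton]
      congr 1
      simp [hφ, extInversion]
    obtain ⟨t, ht, h⟩ := exists_add_eq_of_inter_eq_infty hd ((hL.isometry v v).trans hv)
      ((hL.isometry w w).trans hw) himg
    refine ⟨t, c, ht, ?_⟩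
    have h2 := congrArg Φ h
    rw [map_add, hΦ, refl_refl (lor_sphereVec c one_pos), refl_refl (lor_sphereVec c one_pos),
      map_smul, refl_sphereVec_infty c one_pos] at h2
    simpa using h2

theorem lor_eq_neg_one_of_add {v w : Lor d} (hv : lor d v v = 1) (hw : lor d w w = 1) {t : ℝ}
    {p : ExtEucl d} (h : v + w = t • nullVec p) : lor d v w = -1 := by
  have h1 : lor d (v + w) (v + w) = 0 := by
    rw [h]
    simp [lor_nullVec_self]
  simp only [map_add, LinearMap.add_apply, hv, hw, lor_comm w v] at h1
  linarith

theorem lor_eq_neg_one_of_tangent (hd : 0 < d) {v w : Lor d} (hv : lor d v v = 1)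
    (hw : lor d w w = 1) (h : Tangent (ball v) (ball w)) : lor d v w = -1 := by
  obtain ⟨t, p, -, h⟩ := exists_add_eq_of_tangent hd hv hw h
  exact lor_eq_neg_one_of_add hv hw h

/-! ### Congruence of Descartes configurations -/

/-- The orthogonal complement of a timelike vector is positive definite. -/
theorem lor_pos_of_orthogonal_timelike {s w : Lor d} (hs : lor d s s < 0) (hw : lor d w s = 0)
    (hw0 : w ≠ 0) : 0 < lor d w w := by
  obtain ⟨a, k, k'⟩ := s
  obtain ⟨b, l, l'⟩ := w
  simp only [lor_apply, real_inner_self_eq_norm_sq] at hs hw ⊢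
  by_contra hle
  have hab : (inner ℝ b a) ^ 2 ≤ ‖b‖ ^ 2 * ‖a‖ ^ 2 := by
    rw [← mul_pow, ← sq_abs]
    exact pow_le_pow_left₀ (abs_nonneg _) (abs_real_inner_le_norm b a) 2
  have h1 : ‖a‖ ^ 2 < k * k' := by linarith
  have h2 : ‖b‖ ^ 2 ≤ l * l' := by linarith
  have ha := sq_nonneg ‖a‖
  have hb := sq_nonneg ‖b‖
  have h3 : inner ℝ b a = (l * k' + l' * k) / 2 := by linarith
  rw [h3] at hab
  have hkk : 0 < k * k' := by linarith
  have h4 : l * l' * (k * k') ≤ ((l * k' + l' * k) / 2) ^ 2 := by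
    linarith [sq_nonneg (l * k' - l' * k)]
  have h5 : ‖b‖ ^ 2 * (k * k') ≤ l * l' * (k * k') := mul_le_mul_of_nonneg_right h2 hkk.le
  have h6 : ‖b‖ ^ 2 * (k * k' - ‖a‖ ^ 2) ≤ 0 := by linarith
  have h7 : ‖b‖ ^ 2 = 0 := by
    by_contra hne
    have : 0 < ‖b‖ ^ 2 := lt_of_le_of_ne hb (Ne.symm hne)
    linarith [mul_pos this (sub_pos.2 h1)]
  rw [h7] at hab h5
  have h8 : (l * k' + l' * k) / 2 = 0 := by
    have : ((l * k' + l' * k) / 2) ^ 2 = 0 := le_antisymm (by linarith) (sq_nonneg _)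
    exact pow_eq_zero_iff two_ne_zero |>.1 this
  have h9 : l * k' = 0 ∧ l' * k = 0 := by
    have e1 : l * k' - l' * k = 0 := by
      have : (l * k' - l' * k) ^ 2 = 0 := by
        refine le_antisymm ?_ (sq_nonneg _)
        have : (l * k' - l' * k) ^ 2 = 4 * ((l * k' + l' * k) / 2) ^ 2 - 4 * (l * l' * (k * k')) := by
          ring
        rw [this, h8]
        linarith
      exact pow_eq_zero_iff two_ne_zero |>.1 this
    constructor <;> linarith
  have hk : k ≠ 0 := left_ne_zero_of_mul hkk.ne'
  have hk' : k' ≠ 0 := right_ne_zero_of_mul hkk.ne'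
  apply hw0
  have hb0 : b = 0 := by simpa using h7
  have hl0 : l = 0 := (mul_eq_zero.1 h9.1).resolve_right hk'
  have hl0' : l' = 0 := (mul_eq_zero.1 h9.2).resolve_right hk
  simp [hb0, hl0, hl0']

/-- Two vectors of equal square and spacelike difference are exchanged by a reflection that fixes
all vectors orthogonal to the difference. -/
theorem exists_lifts_of_spacelike_sub {a b : Lor d} (hab : lor d a a = lor d b b)
    (h : a ≠ b → 0 < lor d (a - b) (a - b)) :
    ∃ φ Φ, Lifts φ Φ ∧ Φ a = b ∧ ∀ c, lor d (a - b) c = 0 → Φ c = c := by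
  rcases eq_or_ne a b with rfl | hne
  · exact ⟨1, _, Lifts.one, rfl, fun c _ => rfl⟩
  have hpos := h hne
  set m := lor d (a - b) (a - b) with hm
  set u : Lor d := (Real.sqrt m)⁻¹ • (a - b) with hu
  have hsq : (Real.sqrt m)⁻¹ * (Real.sqrt m)⁻¹ = m⁻¹ := by
    rw [← mul_inv, Real.mul_self_sqrt hpos.le]
  have hu1 : lor d u u = 1 := by
    rw [hu, map_smul, map_smul, LinearMap.smul_apply, smul_eq_mul, smul_eq_mul, ← mul_assoc, hsq,
      ← hm, inv_mul_cancel₀ hpos.ne']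
  have hrefl : ∀ c, refl u c = c - (2 * m⁻¹ * lor d (a - b) c) • (a - b) := by
    intro c
    rw [refl_apply, hu, map_smul, LinearMap.smul_apply, smul_eq_mul, smul_smul, ← hsq]
    congr 2
    ring
  obtain ⟨φ, hφ⟩ := exists_lifts_refl hu1
  refine ⟨φ, _, hφ, ?_, fun c hc => by rw [hrefl, hc]; simp⟩
  have h2 : 2 * lor d (a - b) a = m := by
    rw [hm]
    simp only [map_sub, LinearMap.sub_apply, lor_comm b a, hab]
    ring
  rw [hrefl, mul_right_comm, h2, mul_inv_cancel₀ hpos.ne']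
  simp

theorem two_smul_sum_eq {L : Type*} [AddCommGroup L] [Module ℝ L] (N : ℕ) [NeZero N]
    (e : Fin N → L) : (2 : ℝ) • ∑ i, e i = ∑ i, (e i + e (i + 1)) := by
  rw [Finset.sum_add_distrib, two_smul]
  exact congrArg _ (Equiv.sum_comp (Equiv.addRight (1 : Fin N)) e).symm

/-- Two ordered systems of `d + 2` pairwise tangent balls are congruent under the Möbius group.
The sums of the two systems are timelike vectors in the same half of the light cone; after a
reflection that takes one to the other, the remaining differences are orthogonal to a timelike
vector, so that further reflections match the systems one vector at a time. -/
theorem exists_lifts_of_tangentFamily (hd : 0 < d) {e e' : Fin (d + 2) → Lor d}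
    (he : IsTangentFamily (lor d) e) (he' : IsTangentFamily (lor d) e')
    (hp : ∀ i j, i ≠ j → ∃ (t : ℝ) (p : ExtEucl d), 0 < t ∧ e i + e j = t • nullVec p)
    (hp' : ∀ i j, i ≠ j → ∃ (t : ℝ) (p : ExtEucl d), 0 < t ∧ e' i + e' j = t • nullVec p) :
    ∃ φ Φ, Lifts φ Φ ∧ ∀ i, Φ (e i) = e' i := by
  have hdR : (0 : ℝ) < d := by exact_mod_cast hd
  have hsum : ∀ {e : Fin (d + 2) → Lor d}, IsTangentFamily (lor d) e → ∀ i,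
      lor d (e i) (∑ j, e j) = -d := fun he i => by
    rw [he.apply_sum]
    simp
  have hself : ∀ {e : Fin (d + 2) → Lor d}, IsTangentFamily (lor d) e →
      lor d (∑ j, e j) (∑ j, e j) = -(d * (d + 2)) := fun {e} he => by
    have : ∀ w, lor d (∑ j, e j) w = ∑ j, lor d (e j) w := fun w => by simp [map_sum]
    rw [this]
    simp [hsum he]
    ring
  set s := ∑ j, e j with hs
  set s' := ∑ j, e' j with hs'
  have hss : lor d s s' ≤ 0 := by
    have hi : ∀ i : Fin (d + 2), i ≠ i + 1 := fun i h => by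
      simp at h
    have h4 : 4 * lor d s s' = lor d ((2 : ℝ) • s) ((2 : ℝ) • s') := by
      simp only [map_smul, LinearMap.smul_apply, smul_eq_mul]
      ring
    have h5 : lor d ((2 : ℝ) • s) ((2 : ℝ) • s') ≤ 0 := by
      rw [hs, hs', two_smul_sum_eq, two_smul_sum_eq]
      simp only [map_sum, LinearMap.sum_apply]
      refine Finset.sum_nonpos fun i _ => Finset.sum_nonpos fun j _ => ?_
      obtain ⟨t, p, ht, h⟩ := hp _ _ (hi j)
      obtain ⟨t', p', ht', h'⟩ := hp' _ _ (hi i)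
      rw [h, h', map_smul, map_smul, LinearMap.smul_apply, smul_eq_mul, smul_eq_mul]
      exact mul_nonpos_of_nonneg_of_nonpos ht'.le
        (mul_nonpos_of_nonneg_of_nonpos ht.le (lor_nullVec_nonpos _ _))
    linarith
  have hneg : -((d : ℝ) * (d + 2)) < 0 := by
    have : 0 < (d : ℝ) * (d + 2) := by positivity
    linarith
  obtain ⟨φ₀, Φ₀, h₀, hΦ₀, -⟩ := exists_lifts_of_spacelike_sub (a := s) (b := s')
    ((hself he).trans (hself he').symm) fun hne => by
      refine lor_pos_of_orthogonal_timelike (s := s + s') ?_ ?_ (sub_ne_zero.2 hne)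
      · simp only [map_add, LinearMap.add_apply, lor_comm s' s]
        rw [hself he, hself he']
        linarith
      · simp only [map_add, map_sub, LinearMap.sub_apply, lor_comm s' s]
        rw [hself he, hself he']
        ring
  have key : ∀ T : Finset (Fin (d + 2)), ∃ φ Φ, Lifts φ Φ ∧ Φ s = s' ∧ ∀ i ∈ T, Φ (e i) = e' i := by
    intro T
    induction T using Finset.induction_on with
    | empty => exact ⟨φ₀, Φ₀, h₀, hΦ₀, by simp⟩
    | insert k T hk ih =>
      obtain ⟨φ, Φ, h, hΦs, hΦ⟩ := ih
      have horth : lor d (Φ (e k) - e' k) s' = 0 := by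
        rw [map_sub, LinearMap.sub_apply, ← hΦs, h.isometry, hsum he, hΦs, hsum he', sub_self]
      obtain ⟨ψ, Ψ, h', hΨ, hfix⟩ := exists_lifts_of_spacelike_sub (a := Φ (e k)) (b := e' k)
        (by rw [h.isometry, he.1, he'.1]) fun hne => by
          refine lor_pos_of_orthogonal_timelike (s := s') ?_ horth (sub_ne_zero.2 hne)
          rw [hself he']
          exact hneg
      refine ⟨ψ * φ, Ψ ∘ₗ Φ, h'.mul h, ?_, ?_⟩
      · rw [LinearMap.comp_apply, hΦs, hfix _ horth]
      · intro i hi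
        rcases Finset.mem_insert.1 hi with rfl | hi
        · exact hΨ
        · have hik : k ≠ i := fun h => hk (h ▸ hi)
          rw [LinearMap.comp_apply, hΦ i hi]
          apply hfix
          rw [map_sub, LinearMap.sub_apply, ← hΦ i hi, h.isometry, hΦ i hi, he.2 k i hik,
            he'.2 k i hik, sub_self]
  obtain ⟨φ, Φ, h, -, hΦ⟩ := key Finset.univ
  exact ⟨φ, Φ, h, fun i => hΦ i (Finset.mem_univ i)⟩

end Lorentz

section Polytope

/-! ### Faces and facets of polytopes -/

/-- A full-dimensional polytope, described as a compact convex set with nonempty interior and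
finitely many extreme points. -/
structure IsPolytope {n : ℕ} (P : Set (Eucl n)) : Prop where
  convex : Convex ℝ P
  isCompact : IsCompact P
  interior_nonempty : (interior P).Nonempty
  finite_extremePoints : (P.extremePoints ℝ).Finite

variable {n : ℕ} {P : Set (Eucl n)}

theorem mem_toExposed {l : StrongDual ℝ (Eucl n)} {x : Eucl n} :
    x ∈ l.toExposed P ↔ x ∈ P ∧ ∀ y ∈ P, l y ≤ l x := Iff.rfl

theorem apply_eq_of_mem_toExposed {l : StrongDual ℝ (Eucl n)} {x y : Eucl n}
    (hx : x ∈ l.toExposed P) (hy : y ∈ l.toExposed P) : l x = l y :=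
  le_antisymm (hy.2 x hx.1) (hx.2 y hy.1)

theorem lt_of_notMem_toExposed {l : StrongDual ℝ (Eucl n)} {x y : Eucl n}
    (hx : x ∈ l.toExposed P) (hy : y ∈ P) (hyn : y ∉ l.toExposed P) : l y < l x := by
  refine lt_of_le_of_ne (hx.2 y hy) fun h => hyn ⟨hy, fun z hz => ?_⟩
  rw [h]
  exact hx.2 z hz

theorem IsPolytope.exposed_eq_convexHull (hP : IsPolytope P) {K : Set (Eucl n)}
    (hK : IsExposed ℝ P K) : K = convexHull ℝ (K ∩ P.extremePoints ℝ) := by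
  have h := closure_convexHull_extremePoints (hK.isCompact hP.isCompact) (hK.convex hP.convex)
  rw [hK.isExtreme.extremePoints_eq] at h
  have hfin : (K ∩ P.extremePoints ℝ).Finite := hP.finite_extremePoints.subset inter_subset_right
  rw [(hfin.isClosed_convexHull (𝕜 := ℝ)).closure_eq] at h
  exact h.symm

theorem IsPolytope.eq_convexHull (hP : IsPolytope P) : P = convexHull ℝ (P.extremePoints ℝ) := by
  have h := hP.exposed_eq_convexHull (IsExposed.refl P)
  rwa [inter_eq_right.2 extremePoints_subset] at h

theorem IsPolytope.finrank_vectorSpan (hP : IsPolytope P) :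
    Module.finrank ℝ (vectorSpan ℝ P) = n := by
  have h := hP.convex.interior_nonempty_iff_affineSpan_eq_top.1 hP.interior_nonempty
  rw [AffineSubspace.vectorSpan_eq_top_of_affineSpan_eq_top _ _ _ h, finrank_top,
    finrank_euclideanSpace_fin]

theorem norm_mul_le_of_closedBall_subset {l : StrongDual ℝ (Eucl n)} {x₀ : Eucl n} {r M : ℝ}
    (hr : 0 < r) (hball : Metric.closedBall x₀ r ⊆ P) (hM : ∀ p ∈ P, l p ≤ M) :
    ‖l‖ * r ≤ M - l x₀ := by
  have h0 : 0 ≤ M - l x₀ := sub_nonneg.2 (hM _ (hball (Metric.mem_closedBall_self hr.le)))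
  have key : ∀ y : Eucl n, ‖y‖ ≤ r → l y ≤ M - l x₀ := by
    intro y hy
    have := hM (x₀ + y) (hball (by simpa using hy))
    rw [map_add] at this
    linarith
  rw [← le_div_iff₀ hr]
  refine ContinuousLinearMap.opNorm_le_bound _ (by positivity) fun y => ?_
  rcases eq_or_ne y 0 with rfl | hy
  · simp
  have hy0 : 0 < ‖y‖ := norm_pos_iff.2 hy
  have hn : ‖(r / ‖y‖) • y‖ = r := by
    rw [norm_smul, Real.norm_of_nonneg (by positivity), div_mul_cancel₀ _ hy0.ne']
  have h1 := key _ hn.le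
  have h2 := key (-((r / ‖y‖) • y)) (by rw [norm_neg, hn])
  rw [map_neg, map_smul, smul_eq_mul] at h2
  rw [map_smul, smul_eq_mul] at h1
  have h3 : r / ‖y‖ * |l y| ≤ M - l x₀ := by
    rcases abs_cases (l y) with ⟨h, -⟩ | ⟨h, -⟩ <;> rw [h] <;> linarith
  rw [Real.norm_eq_abs, div_mul_eq_mul_div, le_div_iff₀ hr]
  rw [div_mul_eq_mul_div, div_le_iff₀ hy0] at h3
  linarith

theorem lt_of_mem_interior {l : StrongDual ℝ (Eucl n)} (hl : l ≠ 0) {x₀ : Eucl n}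
    (hx₀ : x₀ ∈ interior P) {M : ℝ} (hM : ∀ p ∈ P, l p ≤ M) : l x₀ < M := by
  obtain ⟨r, hr, hball⟩ := Metric.nhds_basis_closedBall.mem_iff.1 (mem_interior_iff_mem_nhds.1 hx₀)
  have h := norm_mul_le_of_closedBall_subset hr hball hM
  have := mul_pos (norm_pos_iff.2 hl) hr
  linarith

/-- A supporting functional of `P` at `w` can be replaced by the functional of a facet through
`w`, without losing the inequality `l w ≤ l v`: among the functionals supporting `P` at `w`,
normalized to have a given value at an interior point, an extreme point of the set of those
maximizing `l v - l w` defines a facet. -/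
theorem IsPolytope.exists_facet (hP : IsPolytope P) {w v : Eucl n} (hw : w ∈ P)
    {l₀ : StrongDual ℝ (Eucl n)} (hl₀ : l₀ ≠ 0) (hsup : ∀ p ∈ P, l₀ p ≤ l₀ w)
    (hv : l₀ w ≤ l₀ v) :
    ∃ l : StrongDual ℝ (Eucl n), IsFacet P (l.toExposed P) ∧ w ∈ l.toExposed P ∧ l w ≤ l v := by
  obtain ⟨x₀, hx₀⟩ := hP.interior_nonempty
  obtain ⟨r, hr, hball⟩ := Metric.nhds_basis_closedBall.mem_iff.1 (mem_interior_iff_mem_nhds.1 hx₀)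
  set K : Set (StrongDual ℝ (Eucl n)) := {l | (∀ p ∈ P, l p ≤ l w) ∧ l (x₀ - w) = -1} with hKdef
  have happ : ∀ x : Eucl n, Continuous fun l : StrongDual ℝ (Eucl n) => l x := fun x =>
    (ContinuousLinearMap.apply ℝ ℝ x).continuous
  have hKcl : IsClosed K := by
    have h1 : K = (⋂ p ∈ P, {l | l p ≤ l w}) ∩ {l | l (x₀ - w) = -1} := by
      ext l
      simp [hKdef]
    rw [h1]
    exact (isClosed_biInter fun p _ => isClosed_le (happ p) (happ w)).inter
      (isClosed_eq (happ _) continuous_const)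
  have hKb : Bornology.IsBounded K := by
    refine (Metric.isBounded_closedBall (x := (0 : StrongDual ℝ (Eucl n))) (r := 1 / r)).subset ?_
    rintro l ⟨h1, h2⟩
    have := norm_mul_le_of_closedBall_subset hr hball h1
    rw [map_sub] at h2
    rw [mem_closedBall_zero_iff, le_div_iff₀ hr]
    linarith
  have hKc : IsCompact K := Metric.isCompact_of_isClosed_isBounded hKcl hKb
  -- normalizing `l₀` gives a member of `K`
  set δ : ℝ := l₀ w - l₀ x₀ with hδ
  have hδ0 : 0 < δ := sub_pos.2 (lt_of_mem_interior hl₀ hx₀ hsup)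
  have hmem : δ⁻¹ • l₀ ∈ K := by
    refine ⟨fun p hp => ?_, ?_⟩
    · simpa using mul_le_mul_of_nonneg_left (hsup p hp) (inv_pos.2 hδ0).le
    · have h1 : l₀ (x₀ - w) = -δ := by rw [map_sub, hδ]; ring
      rw [smul_apply, h1, smul_eq_mul, mul_neg, inv_mul_cancel₀ hδ0.ne']
  set ev : StrongDual ℝ (StrongDual ℝ (Eucl n)) := ContinuousLinearMap.apply ℝ ℝ (v - w) with hev
  have hexp : IsExposed ℝ K (ev.toExposed K) := ContinuousLinearMap.toExposed.isExposed
  have hne : (ev.toExposed K).Nonempty := by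
    obtain ⟨l, hl, hmax⟩ := hKc.exists_isMaxOn ⟨_, hmem⟩ ev.continuous.continuousOn
    exact ⟨l, hl, fun y hy => hmax hy⟩
  obtain ⟨l, hl⟩ := (hexp.isCompact hKc).extremePoints_nonempty hne
  have hlK : l ∈ K.extremePoints ℝ := hexp.isExtreme.extremePoints_subset_extremePoints hl
  have hlv : l w ≤ l v := by
    have h1 : ev (δ⁻¹ • l₀) ≤ ev l := hl.1.2 _ hmem
    have h2 : 0 ≤ ev (δ⁻¹ • l₀) := by
      rw [map_smul, smul_eq_mul]
      refine mul_nonneg (inv_pos.2 hδ0).le ?_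
      simpa [hev] using hv
    have h3 : ev l = l v - l w := by simp [hev]
    linarith
  obtain ⟨⟨hlsup, hlx⟩, hext⟩ := hlK
  have hwG : w ∈ l.toExposed P := ⟨hw, hlsup⟩
  have hl0 : l ≠ 0 := by
    rintro rfl
    simp at hlx
  refine ⟨l, ⟨⟨w, hwG⟩, ContinuousLinearMap.toExposed.isExposed, ?_⟩, hwG, hlv⟩
  set G := l.toExposed P with hG
  have hker : Module.finrank ℝ (LinearMap.ker (l : Eucl n →ₗ[ℝ] ℝ)) + 1 = n := by
    have h := Module.Dual.finrank_ker_add_one_of_ne_zero (f := (l : Eucl n →ₗ[ℝ] ℝ))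
      (fun h => hl0 (ContinuousLinearMap.coe_injective h))
    rwa [finrank_euclideanSpace_fin] at h
  have hGker : vectorSpan ℝ G ≤ LinearMap.ker (l : Eucl n →ₗ[ℝ] ℝ) := by
    rw [vectorSpan_def, Submodule.span_le]
    rintro _ ⟨x, hx, y, hy, rfl⟩
    simp [apply_eq_of_mem_toExposed hx hy]
  by_contra hcontra
  have hlt : Module.finrank ℝ (vectorSpan ℝ G) + 1 < n := by
    have := Submodule.finrank_mono hGker
    omega
  -- otherwise some functional `m` vanishes on the face and on `x₀ - w`, and `l ± ε m ∈ K`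
  obtain ⟨m, hm0, hmker⟩ := Submodule.exists_le_ker_of_lt_top
    (vectorSpan ℝ G ⊔ Submodule.span ℝ {x₀ - w}) (by
      refine Submodule.lt_top_of_finrank_lt_finrank ?_
      rw [finrank_euclideanSpace_fin]
      refine lt_of_le_of_lt ((Submodule.finrank_add_le_finrank_add_finrank _ _).trans ?_) hlt
      gcongr
      simpa using finrank_span_le_card (R := ℝ) ({x₀ - w} : Set (Eucl n)))
  have hmG : ∀ p ∈ G, m p = m w := by
    intro p hp
    have : m (p - w) = 0 := hmker (Submodule.mem_sup_left (vsub_mem_vectorSpan ℝ hp hwG))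
    rwa [map_sub, sub_eq_zero] at this
  have hmx : m (x₀ - w) = 0 :=
    hmker (Submodule.mem_sup_right (Submodule.mem_span_singleton_self _))
  obtain ⟨ε, hε, hε0⟩ : ∃ ε : ℝ, (∀ p ∈ P.extremePoints ℝ, ε * |m (p - w)| ≤ l w - l p) ∧
      0 < ε := by
    have h1 : ∀ᶠ ε : ℝ in nhdsWithin 0 (Ioi 0),
        ∀ p ∈ P.extremePoints ℝ, ε * |m (p - w)| ≤ l w - l p := by
      rw [Filter.eventually_all_finite hP.finite_extremePoints]
      intro p hp
      by_cases hpG : p ∈ G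
      · have e1 : m (p - w) = 0 := by rw [map_sub, hmG p hpG, sub_self]
        have e2 := apply_eq_of_mem_toExposed hpG hwG
        exact Filter.Eventually.of_forall fun ε => by simp [e1, e2]
      · have e1 : 0 < l w - l p := sub_pos.2 (lt_of_notMem_toExposed hwG hp.1 hpG)
        have e2 : Filter.Tendsto (fun ε : ℝ => ε * |m (p - w)|) (nhds 0) (nhds 0) := by
          have e3 := (Filter.tendsto_id (x := nhds (0 : ℝ))).mul_const |m (p - w)|
          simpa only [id, zero_mul] using e3
        exact ((e2.eventually (gt_mem_nhds e1)).filter_mono nhdsWithin_le_nhds).mono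
          fun ε h => h.le
    exact (h1.and self_mem_nhdsWithin).exists
  have hpert : ∀ s : ℝ, |s| = ε → l + s • LinearMap.toContinuousLinearMap m ∈ K := by
    intro s hs
    refine ⟨?_, ?_⟩
    · have hconv : Convex ℝ {p : Eucl n | (l + s • LinearMap.toContinuousLinearMap m) p ≤
          (l + s • LinearMap.toContinuousLinearMap m) w} :=
        convex_halfSpace_le (LinearMap.isLinear
          (l + s • LinearMap.toContinuousLinearMap m : StrongDual ℝ (Eucl n)).toLinearMap) _
      have hsub := convexHull_min (𝕜 := ℝ) (s := P.extremePoints ℝ) (fun p hp => ?_) hconv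
      · rw [← hP.eq_convexHull] at hsub
        exact fun p hp => hsub hp
      · have h1 := hε p hp
        have h2 : s * m (p - w) ≤ ε * |m (p - w)| := by
          rw [← hs, ← abs_mul]
          exact le_abs_self _
        rw [map_sub] at h1 h2
        simp only [mem_ofPred_eq, add_apply, smul_apply,
          LinearMap.coe_toContinuousLinearMap', smul_eq_mul]
        linarith
    · simp only [add_apply, smul_apply,
          LinearMap.coe_toContinuousLinearMap', smul_eq_mul, hmx, hlx]
      simp
  have heq := hext (hpert ε (abs_of_pos hε0)) (hpert (-ε) (by rw [abs_neg, abs_of_pos hε0]))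
    ⟨1 / 2, 1 / 2, by norm_num, by norm_num, by norm_num, by module⟩
  have h2 : ε • LinearMap.toContinuousLinearMap m = 0 := by simpa using heq
  rcases smul_eq_zero.1 h2 with h3 | h3
  · exact hε0.ne' h3
  · exact hm0 (by simpa using h3)

theorem IsPolytope.facet_ne (hP : IsPolytope P) {F : Set (Eucl n)} (hF : IsFacet P F) : F ≠ P := by
  rintro rfl
  have := hF.2.2
  rw [hP.finrank_vectorSpan] at this
  omega

theorem IsPolytope.functional_ne_zero (hP : IsPolytope P) {l : StrongDual ℝ (Eucl n)}
    (hl : IsFacet P (l.toExposed P)) : l ≠ 0 := by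
  rintro rfl
  refine hP.facet_ne hl ?_
  ext x
  simp [mem_toExposed]

/-- The functional that supports a polytope at a facet is unique up to a nonnegative factor. -/
theorem IsPolytope.exists_eq_smul (hP : IsPolytope P) {l l' : StrongDual ℝ (Eucl n)}
    (hl : IsFacet P (l.toExposed P)) (hl' : l.toExposed P ⊆ l'.toExposed P) :
    ∃ c : ℝ, 0 ≤ c ∧ l' = c • l := by
  have hl0 := hP.functional_ne_zero hl
  obtain ⟨x₀, hx₀⟩ := hP.interior_nonempty
  obtain ⟨w, hw⟩ := hl.1
  have hlt : l x₀ < l w := lt_of_mem_interior hl0 hx₀ hw.2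
  have hker : Module.finrank ℝ (LinearMap.ker (l : Eucl n →ₗ[ℝ] ℝ)) + 1 = n := by
    have h := Module.Dual.finrank_ker_add_one_of_ne_zero (f := (l : Eucl n →ₗ[ℝ] ℝ))
      (fun h => hl0 (ContinuousLinearMap.coe_injective h))
    rwa [finrank_euclideanSpace_fin] at h
  have hspan : ∀ m : StrongDual ℝ (Eucl n), l.toExposed P ⊆ m.toExposed P →
      vectorSpan ℝ (l.toExposed P) ≤ LinearMap.ker (m : Eucl n →ₗ[ℝ] ℝ) := by
    intro m hm
    rw [vectorSpan_def, Submodule.span_le]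
    rintro _ ⟨x, hx, y, hy, rfl⟩
    simp [apply_eq_of_mem_toExposed (hm hx) (hm hy)]
  have hkereq := Submodule.eq_of_le_of_finrank_eq (hspan l subset_rfl)
    (by have := hl.2.2; omega)
  have hle : ∀ x, l x = 0 → l' x = 0 := by
    intro x hx
    have h1 : x ∈ LinearMap.ker (l : Eucl n →ₗ[ℝ] ℝ) := hx
    rw [← hkereq] at h1
    exact hspan l' hl' h1
  set y := x₀ - w with hy
  have hly : l y < 0 := by rw [hy, map_sub]; linarith
  have hly' : l' y ≤ 0 := by
    rw [hy, map_sub, sub_nonpos]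
    exact (hl' hw).2 _ (interior_subset hx₀)
  refine ⟨l' y / l y, div_nonneg_of_nonpos hly' hly.le, ?_⟩
  ext x
  have h1 : l' (x - (l x / l y) • y) = 0 := by
    apply hle
    rw [map_sub, map_smul, smul_eq_mul, div_mul_cancel₀ _ hly.ne, sub_self]
  rw [map_sub, map_smul, smul_eq_mul, sub_eq_zero] at h1
  rw [h1, smul_apply, smul_eq_mul]
  ring

/-- If an exposed face does not contain the facet `F`, each of its points is on a facet other
than `F`. -/
theorem IsPolytope.exists_other_facet (hP : IsPolytope P) {F H : Set (Eucl n)} (hF : IsFacet P F)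
    (hH : IsExposed ℝ P H) (hFH : ¬ F ⊆ H) {w : Eucl n} (hw : w ∈ H) :
    ∃ G, IsFacet P G ∧ G ≠ F ∧ w ∈ G := by
  obtain ⟨l, rfl⟩ : ∃ l : StrongDual ℝ (Eucl n), H = l.toExposed P := hH ⟨w, hw⟩
  obtain ⟨lF, rfl⟩ : ∃ l : StrongDual ℝ (Eucl n), F = l.toExposed P := hF.2.1 hF.1
  have hl0 : l ≠ 0 := by
    rintro rfl
    exact hFH fun x hx => ⟨hx.1, by simp⟩
  by_cases hwF : w ∈ lF.toExposed P
  · obtain ⟨p, hpF, hpH⟩ := not_subset.1 hFH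
    obtain ⟨q, hq⟩ := hP.interior_nonempty
    have hlp : 0 < l w - l p := sub_pos.2 (lt_of_notMem_toExposed hw hpF.1 hpH)
    have hlq : lF q < lF w := lt_of_mem_interior (hP.functional_ne_zero hF) hq hwF.2
    -- a direction that leaves `P` through the face `H` but stays beneath `F`
    set t : ℝ := (l w - l q) / (l w - l p) with ht
    set u : Eucl n := w + ((q - w) + t • (w - p)) with hu
    have hlu : l u = l w := by
      simp only [hu, map_add, map_sub, map_smul, smul_eq_mul, ht]
      field_simp
      ring
    have hlFu : lF u < lF w := by
      simp only [hu, map_add, map_sub, map_smul, smul_eq_mul,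
        apply_eq_of_mem_toExposed hwF hpF]
      rw [apply_eq_of_mem_toExposed hwF hpF] at hlq
      linarith
    obtain ⟨m, hm, hwm, hmu⟩ := hP.exists_facet hw.1 hl0 hw.2 hlu.ge
    refine ⟨_, hm, fun heq => ?_, hwm⟩
    obtain ⟨c, hc, rfl⟩ := hP.exists_eq_smul hF heq.ge
    have hc0 : c ≠ 0 := by
      rintro rfl
      exact hP.functional_ne_zero hm (zero_smul ℝ lF)
    have h1 : c * lF w ≤ c * lF u := hmu
    have h2 := mul_lt_mul_of_pos_left hlFu (lt_of_le_of_ne hc hc0.symm)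
    linarith
  · obtain ⟨m, hm, hwm, -⟩ := hP.exists_facet hw.1 hl0 hw.2 le_rfl
    exact ⟨_, hm, fun heq => hwF (heq ▸ hwm), hwm⟩

/-- In dimension at least `3`, every edge is contained in a facet other than a given one. -/
theorem IsPolytope.exists_other_facet_of_edge (hP : IsPolytope P) (hn : 3 ≤ n)
    {F : Set (Eucl n)} (hF : IsFacet P F) {x y : Eucl n} (hxy : IsExposed ℝ P (segment ℝ x y)) :
    ∃ G, IsFacet P G ∧ G ≠ F ∧ segment ℝ x y ⊆ G := by
  have hFs : ¬ F ⊆ segment ℝ x y := by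
    intro h
    have h1 := Submodule.finrank_mono (vectorSpan_mono ℝ h)
    rw [vectorSpan_segment] at h1
    have h2 := finrank_span_le_card (R := ℝ) ({y -ᵥ x} : Set (Eucl n))
    rw [Set.toFinset_singleton, Finset.card_singleton] at h2
    have h3 := hF.2.2
    omega
  have hmid : midpoint ℝ x y ∈ segment ℝ x y := midpoint_mem_segment x y
  obtain ⟨G, hG, hGF, hw⟩ := hP.exists_other_facet hF hxy hFs hmid
  refine ⟨G, hG, hGF, ?_⟩
  have hx : x ∈ P := hxy.subset (left_mem_segment ℝ x y)
  have hy : y ∈ P := hxy.subset (right_mem_segment ℝ x y)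
  have hopen : midpoint ℝ x y ∈ openSegment ℝ x y :=
    ⟨1 / 2, 1 / 2, by norm_num, by norm_num, by norm_num, by
      rw [midpoint_eq_smul_add]; simp [smul_add]⟩
  have hxG := hG.2.1.isExtreme.left_mem_of_mem_openSegment hx hy hw hopen
  have hyG := hG.2.1.isExtreme.right_mem_of_mem_openSegment hx hy hw hopen
  exact (hG.2.1.convex hP.convex).segment_subset hxG hyG

/-! ### The simplicial structure of stacked polytopes -/

/-- The face `F` of `P` is a simplex with `n` vertices that are pairwise adjacent in the graph of
`P`, and some further vertex of `P` is adjacent to all of them. -/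
def IsCliqueFacet (P F : Set (Eucl n)) : Prop :=
  ∃ (T : Finset (Eucl n)) (u : Eucl n), T.card = n ∧ (T : Set (Eucl n)) ⊆ P.extremePoints ℝ ∧
    F = convexHull ℝ (T : Set (Eucl n)) ∧
    (∀ x ∈ T, ∀ y ∈ T, x ≠ y → IsExposed ℝ P (segment ℝ x y)) ∧
    u ∈ P.extremePoints ℝ ∧ u ∉ T ∧ ∀ x ∈ T, IsExposed ℝ P (segment ℝ u x)

/-- The properties of polytopes that are propagated by stacking: all vertices are exposed, and
the vertices of each facet form a clique to which some further vertex is joined. -/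
structure IsCliquePolytope (P : Set (Eucl n)) : Prop extends IsPolytope P where
  isExposed_singleton : ∀ w ∈ P.extremePoints ℝ, IsExposed ℝ P {w}
  isCliqueFacet : ∀ F, IsFacet P F → IsCliqueFacet P F

theorem mem_extremePoints_of_isExposed {w : Eucl n} (h : IsExposed ℝ P {w}) :
    w ∈ P.extremePoints ℝ := isExtreme_singleton.1 h.isExtreme

/-! ### The simplex -/

section Simplex

variable {p : Fin (n + 1) → Eucl n}

/-- Every set of vertices of a simplex spans a face: it is exposed by the sum of its barycentric
coordinates. -/
theorem isExposed_convexHull_image (hp : AffineIndependent ℝ p) (I : Set (Fin (n + 1))) :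
    IsExposed ℝ (convexHull ℝ (range p)) (convexHull ℝ (p '' I)) := by
  classical
  rintro hne
  obtain ⟨i₀, hi₀⟩ : I.Nonempty := by
    rcases I.eq_empty_or_nonempty with rfl | h
    · simp at hne
    · exact h
  have htop : affineSpan ℝ (range p) = ⊤ :=
    hp.affineSpan_eq_top_iff_card_eq_finrank_add_one.2 (by simp)
  let b : AffineBasis (Fin (n + 1)) ℝ (Eucl n) := ⟨p, hp, htop⟩
  let f : Eucl n →ᵃ[ℝ] ℝ := ∑ i with i ∈ I, b.coord i
  have hf : ∀ x, f x = ∑ i with i ∈ I, b.coord i x := fun x => by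
    have h : ∀ s : Finset (Fin (n + 1)), (∑ i ∈ s, b.coord i) x = ∑ i ∈ s, b.coord i x := by
      intro s
      induction s using Finset.induction_on with
      | empty => simp
      | insert a s ha ih => rw [Finset.sum_insert ha, Finset.sum_insert ha, ← ih]; rfl
    exact h _
  have hfp : ∀ j, f (p j) = if j ∈ I then 1 else 0 := by
    intro j
    have h1 : ∀ i, b.coord i (p j) = if i = j then 1 else 0 := fun i => b.coord_apply i j
    rw [hf]
    simp only [h1, Finset.sum_ite_eq', Finset.mem_filter, Finset.mem_univ, true_and]
  let l : StrongDual ℝ (Eucl n) := LinearMap.toContinuousLinearMap f.linear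
  have hl : ∀ x, l x = f x - f 0 := fun x => by
    have h : f.linear x = f x - f 0 := by simpa using f.linearMap_vsub x 0
    exact h
  have hle : ∀ x ∈ convexHull ℝ (range p), l x ≤ l (p i₀) := by
    have hconv : Convex ℝ {x : Eucl n | l x ≤ l (p i₀)} :=
      convex_halfSpace_le (LinearMap.isLinear l.toLinearMap) _
    refine fun x hx => convexHull_min ?_ hconv hx
    rintro _ ⟨j, rfl⟩
    simp only [mem_ofPred_eq, hl, hfp, hi₀, if_true]
    split_ifs <;> linarith
  refine ⟨l, Subset.antisymm ?_ ?_⟩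
  · have hcv : Convex ℝ (l.toExposed (convexHull ℝ (range p))) :=
      ContinuousLinearMap.toExposed.isExposed.convex (convex_convexHull ℝ _)
    refine convexHull_min ?_ hcv
    rintro _ ⟨j, hj, rfl⟩
    refine ⟨subset_convexHull ℝ _ (mem_range_self j), fun y hy => (hle y hy).trans ?_⟩
    simp [hl, hfp, hi₀, hj]
  · have hK : IsExposed ℝ (convexHull ℝ (range p)) (l.toExposed (convexHull ℝ (range p))) :=
      ContinuousLinearMap.toExposed.isExposed
    have hc := (finite_range p).isCompact_convexHull (𝕜 := ℝ)
    have h := closure_convexHull_extremePoints (hK.isCompact hc)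
      (hK.convex (convex_convexHull ℝ _))
    have hsub : (l.toExposed (convexHull ℝ (range p))).extremePoints ℝ ⊆ p '' I := by
      intro x hx
      obtain ⟨j, rfl⟩ := extremePoints_convexHull_subset
        (hK.isExtreme.extremePoints_subset_extremePoints hx)
      refine ⟨j, ?_, rfl⟩
      by_contra hj
      have h1 := hx.1.2 (p i₀) (subset_convexHull ℝ _ (mem_range_self i₀))
      rw [hl, hl, hfp, hfp, if_pos hi₀, if_neg hj] at h1
      linarith
    change l.toExposed (convexHull ℝ (range p)) ⊆ _
    rw [← h]
    exact closure_minimal (convexHull_mono hsub)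
      ((toFinite (p '' I)).isClosed_convexHull (𝕜 := ℝ))

theorem extremePoints_simplex (hp : AffineIndependent ℝ p) :
    (convexHull ℝ (range p)).extremePoints ℝ = range p := by
  refine Subset.antisymm extremePoints_convexHull_subset ?_
  rintro _ ⟨i, rfl⟩
  refine mem_extremePoints_of_isExposed ?_
  simpa using isExposed_convexHull_image hp {i}

theorem isExposed_segment_simplex (hp : AffineIndependent ℝ p) (i j : Fin (n + 1)) :
    IsExposed ℝ (convexHull ℝ (range p)) (segment ℝ (p i) (p j)) := by
  have := isExposed_convexHull_image hp {i, j}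
  rwa [image_pair, convexHull_pair] at this

theorem isPolytope_simplex (hp : AffineIndependent ℝ p) : IsPolytope (convexHull ℝ (range p)) where
  convex := convex_convexHull ℝ _
  isCompact := (finite_range p).isCompact_convexHull (𝕜 := ℝ)
  interior_nonempty := interior_convexHull_nonempty_iff_affineSpan_eq_top.2
    (hp.affineSpan_eq_top_iff_card_eq_finrank_add_one.2 (by simp))
  finite_extremePoints := by
    rw [extremePoints_simplex hp]
    exact finite_range p

theorem isCliquePolytope_simplex (hp : AffineIndependent ℝ p) :
    IsCliquePolytope (convexHull ℝ (range p)) where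
  toIsPolytope := isPolytope_simplex hp
  isExposed_singleton := by
    rw [extremePoints_simplex hp]
    rintro _ ⟨i, rfl⟩
    simpa using isExposed_convexHull_image hp {i}
  isCliqueFacet := by
    classical
    intro F hF
    have hP := isPolytope_simplex hp
    set I : Finset (Fin (n + 1)) := Finset.univ.filter fun i => p i ∈ F with hI
    have hFI : F = convexHull ℝ ((I.image p : Finset (Eucl n)) : Set (Eucl n)) := by
      conv_lhs => rw [hP.exposed_eq_convexHull hF.2.1, extremePoints_simplex hp]
      congr 1
      ext x
      simp only [mem_inter_iff, mem_range, Finset.coe_image, mem_image, Finset.mem_coe, hI,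
        Finset.mem_filter, Finset.mem_univ, true_and]
      constructor
      · rintro ⟨hx, i, rfl⟩
        exact ⟨i, hx, rfl⟩
      · rintro ⟨i, hi, rfl⟩
        exact ⟨hi, i, rfl⟩
    have hpos : 0 < I.card := by
      rw [Finset.card_pos, ← Finset.image_nonempty (f := p), ← Finset.coe_nonempty,
        ← convexHull_nonempty_iff (𝕜 := ℝ), ← hFI]
      exact hF.1
    have hge : n ≤ I.card := by
      have h1 := hF.2.2
      have h2 := finrank_vectorSpan_image_finset_le ℝ p I (n := I.card - 1) (by omega)
      rw [hFI, ← direction_affineSpan, affineSpan_convexHull, direction_affineSpan] at h1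
      omega
    obtain ⟨u, hu⟩ : ∃ u, u ∉ I := by
      by_contra h
      push Not at h
      refine hP.facet_ne hF ?_
      rw [hFI, Finset.eq_univ_iff_forall.2 h]
      simp
    have hle : I.card ≤ n := by
      have := Finset.card_lt_univ_of_notMem hu
      rw [Fintype.card_fin] at this
      omega
    refine ⟨I.image p, p u, ?_, ?_, hFI, ?_, ?_, ?_, ?_⟩
    · rw [Finset.card_image_of_injective _ hp.injective]
      omega
    · rw [extremePoints_simplex hp, Finset.coe_image]
      exact image_subset_range _ _
    · intro x hx y hy _
      obtain ⟨i, -, rfl⟩ := Finset.mem_image.1 hx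
      obtain ⟨j, -, rfl⟩ := Finset.mem_image.1 hy
      exact isExposed_segment_simplex hp i j
    · rw [extremePoints_simplex hp]
      exact mem_range_self u
    · rw [Finset.mem_image]
      rintro ⟨i, hi, h⟩
      exact hu (hp.injective h ▸ hi)
    · intro x hx
      obtain ⟨i, -, rfl⟩ := Finset.mem_image.1 hx
      exact isExposed_segment_simplex hp u i

end Simplex

/-! ### Stacking -/

section Stack

variable {F : Set (Eucl n)} {v : Eucl n}

theorem subset_stack : P ⊆ convexHull ℝ (insert v P) :=
  (subset_insert v P).trans (subset_convexHull ℝ _)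

theorem apex_mem_stack : v ∈ convexHull ℝ (insert v P) :=
  subset_convexHull ℝ _ (mem_insert v P)

theorem apply_le_of_mem_stack {f : StrongDual ℝ (Eucl n)} {M : ℝ} (hP : ∀ x ∈ P, f x ≤ M)
    (hv : f v ≤ M) : ∀ x ∈ convexHull ℝ (insert v P), f x ≤ M := by
  have hconv : Convex ℝ {x : Eucl n | f x ≤ M} :=
    convex_halfSpace_le (LinearMap.isLinear f.toLinearMap) _
  have h : insert v P ⊆ {x : Eucl n | f x ≤ M} := insert_subset hv hP
  exact fun x hx => convexHull_min h hconv hx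

theorem IsPolytope.isPolytope_stack (hP : IsPolytope P) (v : Eucl n) :
    IsPolytope (convexHull ℝ (insert v P)) where
  convex := convex_convexHull ℝ _
  isCompact := by
    have h : convexHull ℝ (insert v P) = convexHull ℝ (insert v (P.extremePoints ℝ)) := by
      refine Subset.antisymm (convexHull_min (insert_subset ?_ ?_) (convex_convexHull ℝ _))
        (convexHull_mono (insert_subset_insert extremePoints_subset))
      · exact subset_convexHull ℝ _ (mem_insert _ _)
      · conv_lhs => rw [hP.eq_convexHull]
        exact convexHull_mono (subset_insert _ _)
    rw [h]
    exact (hP.finite_extremePoints.insert v).isCompact_convexHull (𝕜 := ℝ)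
  interior_nonempty := hP.interior_nonempty.mono (interior_mono subset_stack)
  finite_extremePoints := by
    refine (hP.finite_extremePoints.insert v).subset fun x hx => ?_
    rcases extremePoints_convexHull_subset hx with rfl | h
    · exact mem_insert _ _
    · exact mem_insert_of_mem _
        (inter_extremePoints_subset_extremePoints_of_subset subset_stack ⟨h, hx⟩)

theorem extremePoints_stack_subset :
    (convexHull ℝ (insert v P)).extremePoints ℝ ⊆ insert v (P.extremePoints ℝ) := by
  intro x hx
  rcases extremePoints_convexHull_subset hx with rfl | h
  · exact mem_insert _ _
  · exact mem_insert_of_mem _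
      (inter_extremePoints_subset_extremePoints_of_subset subset_stack ⟨h, hx⟩)

/-- A face of the stacked polytope that misses the new vertex is contained in the old polytope. -/
theorem IsPolytope.subset_of_notMem (hP : IsPolytope P) {K : Set (Eucl n)}
    (hK : IsExposed ℝ (convexHull ℝ (insert v P)) K) (hv : v ∉ K) : K ⊆ P := by
  rw [(hP.isPolytope_stack v).exposed_eq_convexHull hK]
  refine convexHull_min ?_ hP.convex
  rintro x ⟨hxK, hx⟩
  rcases extremePoints_stack_subset hx with rfl | h
  · exact absurd hxK hv
  · exact h.1

/-- A face `H` of `P` contained in a facet that `v` is beneath remains a face: a functional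
exposing `H`, plus a large multiple of the functional of the facet, exposes `H` in the stacked
polytope. -/
theorem IsPolytope.isExposed_stack (hP : IsPolytope P) {G H : Set (Eucl n)}
    (hG : IsBeneath P G v) (hH : IsExposed ℝ P H) (hHG : H ⊆ G) :
    IsExposed ℝ (convexHull ℝ (insert v P)) H := by
  rintro ⟨h₀, hh₀⟩
  obtain ⟨l, rfl⟩ : ∃ l : StrongDual ℝ (Eucl n), H = l.toExposed P := hH ⟨h₀, hh₀⟩
  obtain ⟨g, rfl, hg⟩ := hG
  have hδ : 0 < g h₀ - g v := sub_pos.2 (hg h₀ (hHG hh₀))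
  set t : ℝ := |l v - l h₀| / (g h₀ - g v) + 1 with ht
  have ht0 : 0 < t := by positivity
  have htδ : |l v - l h₀| < t * (g h₀ - g v) := by
    rw [ht, add_mul, div_mul_cancel₀ _ hδ.ne']
    linarith
  set f : StrongDual ℝ (Eucl n) := l + t • g with hf
  have hfx : ∀ x, f x = l x + t * g x := fun x => by simp [hf]
  have hfP : ∀ x ∈ P, f x ≤ f h₀ := by
    intro x hx
    rw [hfx, hfx]
    have h1 := hh₀.2 x hx
    have h2 := mul_le_mul_of_nonneg_left ((hHG hh₀).2 x hx) ht0.le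
    linarith
  have hfv : f v < f h₀ := by
    rw [hfx, hfx]
    have := le_abs_self (l v - l h₀)
    linarith
  have hle := apply_le_of_mem_stack hfP hfv.le
  refine ⟨f, Subset.antisymm ?_ ?_⟩
  · intro z hz
    refine ⟨subset_stack hz.1, fun y hy => (hle y hy).trans (le_of_eq ?_)⟩
    rw [hfx, hfx, apply_eq_of_mem_toExposed hh₀ hz, apply_eq_of_mem_toExposed (hHG hh₀) (hHG hz)]
  · change f.toExposed (convexHull ℝ (insert v P)) ⊆ _
    intro z hz
    have hzP : z ∈ P := by
      refine hP.subset_of_notMem ContinuousLinearMap.toExposed.isExposed (fun hv => ?_) hz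
      exact (hv.2 h₀ (subset_stack hh₀.1)).not_gt hfv
    have h1 := hz.2 h₀ (subset_stack hh₀.1)
    rw [hfx, hfx] at h1
    have h2 := mul_le_mul_of_nonneg_left ((hHG hh₀).2 z hzP) ht0.le
    exact ⟨hzP, fun y hy => (hh₀.2 y hy).trans (by linarith)⟩

theorem IsFacet.apex_notMem (hF : IsFacet P F) (hv : IsBeyond P F v) : v ∉ P := by
  obtain ⟨l, rfl, hl⟩ := hv
  obtain ⟨w, hw⟩ := hF.1
  exact fun h => (hw.2 v h).not_gt (hl w hw)

theorem IsPolytope.isExposed_apex (hP : IsPolytope P) (hF : IsFacet P F) (hv : IsBeyond P F v) :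
    IsExposed ℝ (convexHull ℝ (insert v P)) {v} := by
  obtain ⟨l, rfl, hl⟩ := hv
  obtain ⟨w, hw⟩ := hF.1
  refine fun _ => ⟨l, Subset.antisymm ?_ ?_⟩
  · rintro _ rfl
    exact ⟨apex_mem_stack, apply_le_of_mem_stack (fun y hy => (hw.2 y hy).trans (hl w hw).le) le_rfl⟩
  · change l.toExposed (convexHull ℝ (insert v P)) ⊆ _
    rw [(hP.isPolytope_stack v).exposed_eq_convexHull ContinuousLinearMap.toExposed.isExposed]
    refine convexHull_min ?_ (convex_singleton v)
    rintro x ⟨hx, hxe⟩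
    rcases extremePoints_stack_subset hxe with rfl | h
    · rfl
    · have h1 := hx.2 v apex_mem_stack
      have h2 := hw.2 x h.1
      exact absurd (hl w hw) (by linarith)

/-- The new vertex is joined to the vertices of `F`. -/
theorem IsPolytope.isExposed_segment_apex (hP : IsPolytope P) (hF : IsFacet P F)
    (hv : IsBeyond P F v) {w : Eucl n} (hwF : w ∈ F)
    (hw : IsExposed ℝ (convexHull ℝ (insert v P)) {w}) :
    IsExposed ℝ (convexHull ℝ (insert v P)) (segment ℝ v w) := by
  have hvP := hF.apex_notMem hv
  obtain ⟨l, rfl, hl⟩ := hv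
  obtain ⟨m, hm⟩ := hw (singleton_nonempty w)
  change {w} = m.toExposed (convexHull ℝ (insert v P)) at hm
  have hwm : w ∈ m.toExposed (convexHull ℝ (insert v P)) := hm ▸ mem_singleton w
  have huniq : ∀ x ∈ convexHull ℝ (insert v P), x ≠ w → m x < m w := fun x hx hne =>
    lt_of_notMem_toExposed hwm hx fun h => hne (by rwa [← hm] at h)
  have hlv : 0 < l v - l w := sub_pos.2 (hl w hwF)
  have hmv : m v < m w := huniq v apex_mem_stack fun h => hvP (h ▸ hwF.1)
  -- the multiple of `l` that makes the values at `v` and `w` equal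
  set t : ℝ := (m w - m v) / (l v - l w) with ht
  have ht0 : 0 < t := div_pos (sub_pos.2 hmv) hlv
  set f : StrongDual ℝ (Eucl n) := m + t • l with hf
  have hfx : ∀ x, f x = m x + t * l x := fun x => by simp [hf]
  have hfv : f v = f w := by
    have : t * (l v - l w) = m w - m v := div_mul_cancel₀ _ hlv.ne'
    rw [hfx, hfx]
    linarith
  have hfP : ∀ x ∈ P, x ≠ w → f x < f w := by
    intro x hx hne
    have h1 := huniq x (subset_stack hx) hne
    have h2 := mul_le_mul_of_nonneg_left (hwF.2 x hx) ht0.le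
    rw [hfx, hfx]
    linarith
  have hle : ∀ x ∈ convexHull ℝ (insert v P), f x ≤ f w := by
    refine apply_le_of_mem_stack (fun y hy => ?_) hfv.le
    rcases eq_or_ne y w with rfl | hne
    · exact le_rfl
    · exact (hfP y hy hne).le
  refine fun _ => ⟨f, Subset.antisymm ?_ ?_⟩
  · have hcv : Convex ℝ (f.toExposed (convexHull ℝ (insert v P))) :=
      ContinuousLinearMap.toExposed.isExposed.convex (convex_convexHull ℝ _)
    exact hcv.segment_subset ⟨apex_mem_stack, fun y hy => (hle y hy).trans hfv.ge⟩
      ⟨subset_stack hwF.1, hle⟩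
  · change f.toExposed (convexHull ℝ (insert v P)) ⊆ _
    rw [(hP.isPolytope_stack v).exposed_eq_convexHull ContinuousLinearMap.toExposed.isExposed]
    refine convexHull_min ?_ (convex_segment v w)
    rintro x ⟨hx, hxe⟩
    rcases extremePoints_stack_subset hxe with rfl | h
    · exact left_mem_segment ℝ _ _
    · rcases eq_or_ne x w with rfl | hne
      · exact right_mem_segment ℝ _ _
      · exact absurd (hx.2 w (subset_stack hwF.1)) (hfP x h.1 hne).not_ge

theorem IsPolytope.isExposed_segment_stack (hP : IsPolytope P) (hn : 3 ≤ n) (hF : IsFacet P F)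
    (hben : ∀ G, IsFacet P G → G ≠ F → IsBeneath P G v) {x y : Eucl n}
    (hxy : IsExposed ℝ P (segment ℝ x y)) :
    IsExposed ℝ (convexHull ℝ (insert v P)) (segment ℝ x y) := by
  obtain ⟨G, hG, hGF, hsub⟩ := hP.exists_other_facet_of_edge hn hF hxy
  exact hP.isExposed_stack (hben G hG hGF) hxy hsub

theorem IsCliquePolytope.isExposed_singleton_stack (hP : IsCliquePolytope P) (hn : 3 ≤ n)
    (hF : IsFacet P F) (hben : ∀ G, IsFacet P G → G ≠ F → IsBeneath P G v) {w : Eucl n}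
    (hw : w ∈ P.extremePoints ℝ) : IsExposed ℝ (convexHull ℝ (insert v P)) {w} := by
  have h := hP.isExposed_singleton w hw
  rw [← segment_same ℝ w] at h ⊢
  exact hP.isExposed_segment_stack hn hF hben h

theorem IsCliquePolytope.extremePoints_stack (hP : IsCliquePolytope P) (hn : 3 ≤ n)
    (hF : IsFacet P F) (hv : IsBeyond P F v)
    (hben : ∀ G, IsFacet P G → G ≠ F → IsBeneath P G v) :
    (convexHull ℝ (insert v P)).extremePoints ℝ = insert v (P.extremePoints ℝ) := by
  refine Subset.antisymm extremePoints_stack_subset (insert_subset ?_ fun w hw => ?_)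
  · exact mem_extremePoints_of_isExposed (hP.isExposed_apex hF hv)
  · exact mem_extremePoints_of_isExposed (hP.isExposed_singleton_stack hn hF hben hw)

/-- A face of the stacked polytope through the new vertex, if it is exposed by a nonzero
functional, meets the vertices of `P` in vertices of `F` only. -/
theorem IsPolytope.mem_of_apex_mem (hP : IsPolytope P)
    (hben : ∀ G, IsFacet P G → G ≠ F → IsBeneath P G v) {f : StrongDual ℝ (Eucl n)} (hf : f ≠ 0)
    (hv : v ∈ f.toExposed (convexHull ℝ (insert v P))) {w : Eucl n} (hwP : w ∈ P)
    (hw : w ∈ f.toExposed (convexHull ℝ (insert v P))) : w ∈ F := by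
  obtain ⟨l, hl, hwl, hlv⟩ := hP.exists_facet hwP hf (fun p hp => hw.2 p (subset_stack hp))
    (apply_eq_of_mem_toExposed hw hv).le
  by_contra hwF
  obtain ⟨g, hg, hgv⟩ := hben _ hl fun h => hwF (h ▸ hwl)
  obtain ⟨c, hc, rfl⟩ := hP.exists_eq_smul (l := g) (l' := l) (hg ▸ hl) hg.ge
  have hc0 : c ≠ 0 := by
    rintro rfl
    exact hP.functional_ne_zero hl (zero_smul ℝ g)
  have h1 : c * g w ≤ c * g v := hlv
  have h2 := mul_lt_mul_of_pos_left (hgv w hwl) (lt_of_le_of_ne hc hc0.symm)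
  linarith

theorem IsCliquePolytope.stack (hP : IsCliquePolytope P) (hn : 3 ≤ n)
    (hF : IsFacet P F) (hv : IsBeyond P F v)
    (hben : ∀ G, IsFacet P G → G ≠ F → IsBeneath P G v) :
    IsCliquePolytope (convexHull ℝ (insert v P)) where
  toIsPolytope := hP.isPolytope_stack v
  isExposed_singleton := by
    intro w hw
    rcases extremePoints_stack_subset hw with rfl | h
    · exact hP.isExposed_apex hF hv
    · exact hP.isExposed_singleton_stack hn hF hben h
  isCliqueFacet := by
    classical
    intro G hG
    have hP' := hP.isPolytope_stack v
    have hext := hP.extremePoints_stack hn hF hv hben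
    have hedge : ∀ {x y : Eucl n}, IsExposed ℝ P (segment ℝ x y) →
      IsExposed ℝ (convexHull ℝ (insert v P)) (segment ℝ x y) := fun h =>
        hP.isExposed_segment_stack hn hF hben h
    obtain ⟨f, rfl⟩ : ∃ f : StrongDual ℝ (Eucl n), G = f.toExposed (convexHull ℝ (insert v P)) :=
      hG.2.1 hG.1
    by_cases hvG : v ∈ f.toExposed (convexHull ℝ (insert v P))
    · -- a facet through the new vertex replaces one vertex of `F` by it
      obtain ⟨T, -, hcard, hText, hFT, hTedge, -⟩ := hP.isCliqueFacet F hF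
      have hf0 := hP'.functional_ne_zero hG
      have hTF : ∀ x ∈ T, x ∈ F := fun x hx => hFT ▸ subset_convexHull ℝ _ hx
      have hvT : v ∉ T := fun h => hF.apex_notMem hv (hText h).1
      set A := T.filter (· ∈ f.toExposed (convexHull ℝ (insert v P))) with hA
      have hGA : f.toExposed (convexHull ℝ (insert v P)) =
          convexHull ℝ ((insert v A : Finset (Eucl n)) : Set (Eucl n)) := by
        have hcv : Convex ℝ (f.toExposed (convexHull ℝ (insert v P))) :=
          hG.2.1.convex (convex_convexHull ℝ _)
        refine Subset.antisymm ?_ (convexHull_min ?_ hcv)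
        · conv_lhs => rw [hP'.exposed_eq_convexHull hG.2.1]
          refine convexHull_mono ?_
          rintro x ⟨hx, hxe⟩
          rcases extremePoints_stack_subset hxe with rfl | h
          · simp
          · have hxF := hP.mem_of_apex_mem hben hf0 hvG h.1 hx
            have hxT : x ∈ (T : Set (Eucl n)) := by
              have := inter_extremePoints_subset_extremePoints_of_subset hF.2.1.subset ⟨hxF, h⟩
              rw [hFT] at this
              exact extremePoints_convexHull_subset this
            simp only [Finset.coe_insert, mem_insert_iff, Finset.mem_coe, hA, Finset.mem_filter]
            exact Or.inr ⟨hxT, hx⟩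
        · intro x hx
          rcases Finset.mem_insert.1 hx with rfl | hx
          · exact hvG
          · exact (Finset.mem_filter.1 hx).2
      have hAT : A ⊆ T := Finset.filter_subset _ _
      have hvA : v ∉ A := fun h => hvT (hAT h)
      have hAcard : n ≤ A.card + 1 := by
        have h1 := hG.2.2
        rw [hGA, ← direction_affineSpan, affineSpan_convexHull, direction_affineSpan] at h1
        have h2 := finrank_vectorSpan_image_finset_le ℝ (id : Eucl n → Eucl n) (insert v A)
          (Finset.card_insert_of_notMem hvA)
        rw [Finset.image_id] at h2
        omega
      obtain ⟨u, huT, huA⟩ : ∃ u ∈ T, u ∉ A := by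
        by_contra h
        push Not at h
        have hall : F ⊆ f.toExposed (convexHull ℝ (insert v P)) := by
          rw [hFT]
          exact convexHull_min (fun x hx => (Finset.mem_filter.1 (h x hx)).2)
            (hG.2.1.convex (convex_convexHull ℝ _))
        obtain ⟨l, rfl, hl⟩ := hv
        obtain ⟨w, hw⟩ := hF.1
        obtain ⟨c, hc, rfl⟩ := hP.exists_eq_smul (l' := f) hF fun x hx =>
          ⟨hx.1, fun y hy => (hall hx).2 y (subset_stack hy)⟩
        have h1 : c * l v = c * l w := apply_eq_of_mem_toExposed hvG (hall hw)
        rcases mul_eq_mul_left_iff.1 h1 with h2 | h2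
        · exact (hl w hw).ne' h2
        · exact hf0 (by rw [h2, zero_smul])
      have hAe : A = T.erase u := by
        refine Finset.eq_of_subset_of_card_le (fun x hx => ?_) ?_
        · exact Finset.mem_erase.2 ⟨fun h => huA (h ▸ hx), hAT hx⟩
        · rw [Finset.card_erase_of_mem huT, hcard]
          omega
      have hvx : ∀ x ∈ T, IsExposed ℝ (convexHull ℝ (insert v P)) (segment ℝ v x) := fun x hx =>
        hP.isExposed_segment_apex hF hv (hTF x hx)
          (hP.isExposed_singleton_stack hn hF hben (hText hx))
      refine ⟨insert v A, u, ?_, ?_, hGA, ?_, ?_, ?_, ?_⟩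
      · rw [Finset.card_insert_of_notMem hvA, hAe, Finset.card_erase_of_mem huT, hcard]
        omega
      · rw [hext]
        intro x hx
        rcases Finset.mem_insert.1 hx with rfl | hx
        · exact mem_insert _ _
        · exact mem_insert_of_mem _ (hText (hAT hx))
      · intro x hx y hy hxy
        rcases Finset.mem_insert.1 hx with rfl | hx
        · rcases Finset.mem_insert.1 hy with rfl | hy
          · exact absurd rfl hxy
          · exact hvx y (hAT hy)
        · rcases Finset.mem_insert.1 hy with rfl | hy
          · rw [segment_symm]
            exact hvx x (hAT hx)
          · exact hedge (hTedge x (hAT hx) y (hAT hy) hxy)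
      · rw [hext]
        exact mem_insert_of_mem _ (hText huT)
      · rw [Finset.mem_insert, not_or]
        exact ⟨fun h => hvT (h ▸ huT), huA⟩
      · intro x hx
        rcases Finset.mem_insert.1 hx with rfl | hx
        · rw [segment_symm]
          exact hvx u huT
        · exact hedge (hTedge u huT x (hAT hx) fun h => huA (h ▸ hx))
    · -- a facet missing the new vertex is a facet of `P`
      have hsub := hP.subset_of_notMem hG.2.1 hvG
      have hGP : IsFacet P (f.toExposed (convexHull ℝ (insert v P))) :=
        ⟨hG.1, hG.2.1.mono subset_stack hsub, hG.2.2⟩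
      obtain ⟨T, u, hcard, hText, hFT, hTedge, hu, huT, huedge⟩ := hP.isCliqueFacet _ hGP
      refine ⟨T, u, hcard, ?_, hFT, fun x hx y hy hxy => hedge (hTedge x hx y hy hxy), ?_, huT,
        fun x hx => hedge (huedge x hx)⟩
      · rw [hext]
        exact hText.trans (subset_insert _ _)
      · rw [hext]
        exact mem_insert_of_mem _ hu

end Stack

end Polytope

section Realization

variable {d : ℕ}

/-! ### Balls realizing the graph of a stacked polytope -/

theorem IsStackedPolytope.isCliquePolytope {n : ℕ} (hn : 3 ≤ n) {P : Set (Eucl n)}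
    (hP : IsStackedPolytope P) : IsCliquePolytope P := by
  induction hP with
  | simplex p hp => exact isCliquePolytope_simplex hp
  | stack P F v _ hF hv hben ih => exact ih.stack hn hF hv hben

/-- The balls `f x`, for the vertices `x` of `P`, are distinct and tangent along the edges of `P`.
Balls of nonadjacent vertices may be tangent as well. -/
structure IsRealization (P : Set (Eucl (d + 1))) (f : Eucl (d + 1) → Set (ExtEucl d)) : Prop where
  isBall : ∀ x ∈ P.extremePoints ℝ, IsBall (f x)
  injOn : InjOn f (P.extremePoints ℝ)
  tangent : ∀ x ∈ P.extremePoints ℝ, ∀ y ∈ P.extremePoints ℝ, x ≠ y →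
    IsExposed ℝ P (segment ℝ x y) → Tangent (f x) (f y)

variable {P F : Set (Eucl (d + 1))} {v : Eucl (d + 1)} {f : Eucl (d + 1) → Set (ExtEucl d)}

theorem IsRealization.of_stack (hd : 2 ≤ d) (hP : IsCliquePolytope P) (hF : IsFacet P F)
    (hv : IsBeyond P F v) (hben : ∀ G, IsFacet P G → G ≠ F → IsBeneath P G v)
    (hf : IsRealization (convexHull ℝ (insert v P)) f) : IsRealization P f := by
  have hext := hP.extremePoints_stack (by omega) hF hv hben
  have hsub : P.extremePoints ℝ ⊆ (convexHull ℝ (insert v P)).extremePoints ℝ :=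
    hext ▸ subset_insert _ _
  exact ⟨fun x hx => hf.isBall x (hsub hx), hf.injOn.mono hsub, fun x hx y hy hxy h =>
    hf.tangent x (hsub hx) y (hsub hy) hxy
      (hP.isExposed_segment_stack (by omega) hF hben h)⟩

theorem IsRealization.tangent_apex (hd : 2 ≤ d) (hP : IsCliquePolytope P) (hF : IsFacet P F)
    (hv : IsBeyond P F v) (hben : ∀ G, IsFacet P G → G ≠ F → IsBeneath P G v)
    (hf : IsRealization (convexHull ℝ (insert v P)) f) {x : Eucl (d + 1)}
    (hx : x ∈ P.extremePoints ℝ) (hxF : x ∈ F) : Tangent (f x) (f v) := by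
  have hext := hP.extremePoints_stack (by omega) hF hv hben
  refine hf.tangent x (hext ▸ mem_insert_of_mem _ hx) v (hext ▸ mem_insert _ _) ?_ ?_
  · rintro rfl
    exact hF.apex_notMem hv hx.1
  · rw [segment_symm]
    exact hP.isExposed_segment_apex hF hv hxF
      (hP.isExposed_singleton_stack (by omega) hF hben hx)

theorem IsRealization.isApollonian (hd : 2 ≤ d) (hP : IsStackedPolytope P)
    (hf : IsRealization P f) (hS : IsBallPacking (f '' P.extremePoints ℝ)) :
    IsApollonian (f '' P.extremePoints ℝ) := by
  induction hP with
  | simplex p hp =>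
    have hext := extremePoints_simplex hp
    refine .descartes _ ⟨hS, ?_, ?_⟩
    · rw [hf.injOn.encard_image, hext, ← image_univ, hp.injective.encard_image, encard_univ,
        ENat.card_eq_coe_fintype_card, Fintype.card_fin]
      push_cast
      rw [add_assoc]
      norm_num
    · rintro _ ⟨x, hx, rfl⟩ _ ⟨y, hy, rfl⟩ hne
      have hxy : x ≠ y := fun h => hne (h ▸ rfl)
      refine hf.tangent x hx y hy hxy ?_
      rw [hext] at hx hy
      obtain ⟨i, rfl⟩ := hx
      obtain ⟨j, rfl⟩ := hy
      exact isExposed_segment_simplex hp i j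
  | stack P F v hP hF hv hben ih =>
    have hcl := hP.isCliquePolytope (by omega)
    have hext := hcl.extremePoints_stack (by omega) hF hv hben
    have hfP := hf.of_stack hd hcl hF hv hben
    rw [hext, image_insert_eq] at hS ⊢
    obtain ⟨T, u, hcard, hText, hFT, hTedge, -⟩ := hcl.isCliqueFacet F hF
    refine .add _ (f '' T) _ (ih hfP ⟨fun B hB => hS.1 B (mem_insert_of_mem _ hB),
      hS.2.subset (subset_insert _ _)⟩) (image_mono hText) ?_ ?_ (hS.1 _ (mem_insert _ _)) ?_ ?_
    · rw [(hfP.injOn.mono hText).encard_image, encard_coe_eq_coe_finsetCard, hcard]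
      push_cast
      rfl
    · rintro _ ⟨x, hx, rfl⟩ _ ⟨y, hy, rfl⟩ hne
      have hxy : x ≠ y := fun h => hne (h ▸ rfl)
      exact hfP.tangent x (hText hx) y (hText hy) hxy (hTedge x hx y hy hxy)
    · rintro ⟨x, hx, h⟩
      have hxv : x = v := hf.injOn (hext ▸ mem_insert_of_mem _ hx) (hext ▸ mem_insert _ _) h
      exact hF.apex_notMem hv (hxv ▸ hx.1)
    · rintro _ ⟨x, hx, rfl⟩
      exact hf.tangent_apex hd hcl hF hv hben (hText hx)
        (hFT ▸ subset_convexHull ℝ _ hx)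

/-- Two realizations of the graph of a stacked polytope are congruent. For a simplex this is the
congruence of Descartes configurations. A congruence of the realizations of `P` extends to the
stacked polytope, because the two balls tangent to those of the facet `F` are the ball of the new
vertex and that of the vertex of `P` joined to `F`. -/
theorem exists_lifts_of_isRealization (hd : 2 ≤ d) (hP : IsStackedPolytope P)
    {x₁ x₂ : Eucl (d + 1) → Lor d}
    (hx₁ : ∀ w ∈ P.extremePoints ℝ, lor d (x₁ w) (x₁ w) = 1)
    (hx₂ : ∀ w ∈ P.extremePoints ℝ, lor d (x₂ w) (x₂ w) = 1)
    (h₁ : IsRealization P (ball ∘ x₁)) (h₂ : IsRealization P (ball ∘ x₂)) :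
    ∃ φ Φ, Lifts φ Φ ∧ ∀ w ∈ P.extremePoints ℝ, Φ (x₁ w) = x₂ w := by
  have hd0 : 0 < d := by omega
  induction hP with
  | simplex p hp =>
    have hext := extremePoints_simplex hp
    have hmem : ∀ i, p i ∈ (convexHull ℝ (range p)).extremePoints ℝ := fun i => by
      rw [hext]
      exact mem_range_self i
    have htan : ∀ {x : Eucl (d + 1) → Lor d}, IsRealization (convexHull ℝ (range p)) (ball ∘ x) →
        ∀ i j, i ≠ j → Tangent (ball (x (p i))) (ball (x (p j))) := fun h i j hij =>
      h.tangent _ (hmem i) _ (hmem j) (hp.injective.ne hij) (isExposed_segment_simplex hp i j)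
    obtain ⟨φ, Φ, hΦ, h⟩ := exists_lifts_of_tangentFamily hd0 (e := x₁ ∘ p) (e' := x₂ ∘ p)
      ⟨fun i => hx₁ _ (hmem i), fun i j hij => lor_eq_neg_one_of_tangent hd0 (hx₁ _ (hmem i))
        (hx₁ _ (hmem j)) (htan h₁ i j hij)⟩
      ⟨fun i => hx₂ _ (hmem i), fun i j hij => lor_eq_neg_one_of_tangent hd0 (hx₂ _ (hmem i))
        (hx₂ _ (hmem j)) (htan h₂ i j hij)⟩
      (fun i j hij => exists_add_eq_of_tangent hd0 (hx₁ _ (hmem i)) (hx₁ _ (hmem j))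
        (htan h₁ i j hij))
      (fun i j hij => exists_add_eq_of_tangent hd0 (hx₂ _ (hmem i)) (hx₂ _ (hmem j))
        (htan h₂ i j hij))
    refine ⟨φ, Φ, hΦ, fun w hw => ?_⟩
    rw [hext] at hw
    obtain ⟨i, rfl⟩ := hw
    exact h i
  | stack P F v hP hF hv hben ih =>
    have hcl := hP.isCliquePolytope (by omega)
    have hext := hcl.extremePoints_stack (by omega) hF hv hben
    have h₁P := h₁.of_stack hd hcl hF hv hben
    have h₂P := h₂.of_stack hd hcl hF hv hben
    have hsub : ∀ w ∈ P.extremePoints ℝ, w ∈ (convexHull ℝ (insert v P)).extremePoints ℝ :=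
      fun w hw => hext ▸ mem_insert_of_mem _ hw
    have hvext : v ∈ (convexHull ℝ (insert v P)).extremePoints ℝ := hext ▸ mem_insert _ _
    obtain ⟨φ, Φ, hΦ, h⟩ := ih (fun w hw => hx₁ w (hsub w hw)) (fun w hw => hx₂ w (hsub w hw))
      h₁P h₂P
    refine ⟨φ, Φ, hΦ, fun w hw => ?_⟩
    rw [hext] at hw
    rcases hw with rfl | hw
    swap
    · exact h w hw
    obtain ⟨T, u, hcard, hText, hFT, hTedge, hu, huT, huedge⟩ := hcl.isCliqueFacet F hF
    have hTF : ∀ x ∈ T, x ∈ F := fun x hx => hFT ▸ subset_convexHull ℝ _ hx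
    have huw : u ≠ w := fun huw => hF.apex_notMem hv (huw ▸ hu.1)
    have hneg : ∀ {x : Eucl (d + 1) → Lor d},
        (∀ w' ∈ (convexHull ℝ (insert w P)).extremePoints ℝ, lor d (x w') (x w') = 1) →
        IsRealization (convexHull ℝ (insert w P)) (ball ∘ x) →
        ∀ i : T, lor d (x i) (x w) = -1 := fun hx hr i =>
      lor_eq_neg_one_of_tangent hd0 (hx _ (hsub i (hText i.2))) (hx _ hvext)
        (hr.tangent_apex hd hcl hF hv hben (hText i.2) (hTF i i.2))
    have hfam : IsTangentFamily (lor d) fun i : T => x₂ i := by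
      refine ⟨fun i => hx₂ _ (hsub i (hText i.2)), fun i j hij => ?_⟩
      have hij' : (i : Eucl (d + 1)) ≠ j := fun h => hij (Subtype.ext h)
      exact lor_eq_neg_one_of_tangent hd0 (hx₂ _ (hsub i (hText i.2)))
        (hx₂ _ (hsub j (hText j.2)))
        (h₂P.tangent _ (hText i.2) _ (hText j.2) hij' (hTedge i i.2 j j.2 hij'))
    refine hfam.eq_of_ne_of_ne (lor_isSymm d) (x := x₂ u) ?_ ?_ (hx₂ u (hsub u hu)) ?_
      (hx₂ w hvext) ?_ ?_ (hneg hx₂ h₂) ?_ ?_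
    · rw [Fintype.card_coe, hcard]
      omega
    · rw [Fintype.card_coe, hcard, finrank_lor]
    · rw [hΦ.isometry]
      exact hx₁ w hvext
    · intro i
      rw [lor_comm]
      exact lor_eq_neg_one_of_tangent hd0 (hx₂ u (hsub u hu)) (hx₂ _ (hsub i (hText i.2)))
        (h₂P.tangent _ hu _ (hText i.2) (fun h => huT (h ▸ i.2)) (huedge i i.2))
    · intro i
      rw [← h i (hText i.2), hΦ.isometry]
      exact hneg hx₁ h₁ i
    · -- `Φ (x₁ w)` and `x₂ u = Φ (x₁ u)` cut out distinct balls
      intro heq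
      rw [← h u hu] at heq
      have hb := congrArg ball heq
      rw [← hΦ.image, ← hΦ.image] at hb
      exact huw (h₁.injOn hvext (hsub u hu) (φ.injective.image_injective hb)).symm
    · intro heq
      exact huw (h₂.injOn hvext (hsub u hu) (congrArg ball heq)).symm

/-- A graph isomorphism from the graph of `P` to a tangency graph, extended by `∅` to a function
on the whole space. -/
noncomputable def extendIso {S : Set (Set (ExtEucl d))} (f : polytopeGraph P ≃g tangencyGraph S) :
    Eucl (d + 1) → Set (ExtEucl d) :=
  Function.extend Subtype.val (fun v => (f v : Set (ExtEucl d))) fun _ => ∅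

theorem extendIso_apply {S : Set (Set (ExtEucl d))} (f : polytopeGraph P ≃g tangencyGraph S)
    (v : P.extremePoints ℝ) : extendIso f v = f v :=
  Subtype.val_injective.extend_apply _ _ _

theorem isRealization_extendIso {S : Set (Set (ExtEucl d))} (hS : IsBallPacking S)
    (f : polytopeGraph P ≃g tangencyGraph S) : IsRealization P (extendIso f) where
  isBall x hx := by
    rw [extendIso_apply f ⟨x, hx⟩]
    exact hS.1 _ (f _).2
  injOn x hx y hy h := by
    rw [extendIso_apply f ⟨x, hx⟩, extendIso_apply f ⟨y, hy⟩] at h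
    exact congrArg Subtype.val (f.injective (Subtype.ext h))
  tangent x hx y hy hxy h := by
    rw [extendIso_apply f ⟨x, hx⟩, extendIso_apply f ⟨y, hy⟩]
    have hadj : (polytopeGraph P).Adj ⟨x, hx⟩ ⟨y, hy⟩ := ⟨fun h => hxy (congrArg Subtype.val h), h⟩
    exact f.map_adj_iff.2 hadj

theorem image_extendIso {S : Set (Set (ExtEucl d))} (f : polytopeGraph P ≃g tangencyGraph S) :
    extendIso f '' P.extremePoints ℝ = S := by
  ext B
  constructor
  · rintro ⟨x, hx, rfl⟩
    rw [extendIso_apply f ⟨x, hx⟩]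
    exact (f _).2
  · intro hB
    obtain ⟨x, hx⟩ := f.surjective ⟨B, hB⟩
    exact ⟨x, x.2, by rw [extendIso_apply, hx]⟩

theorem IsRealization.exists_vectors (hf : IsRealization P f) :
    ∃ x : Eucl (d + 1) → Lor d, ∀ w ∈ P.extremePoints ℝ,
      lor d (x w) (x w) = 1 ∧ f w = ball (x w) := by
  choose! x hx using fun w (hw : w ∈ P.extremePoints ℝ) => (hf.isBall w hw).exists_eq_ball
  exact ⟨x, hx⟩

theorem IsRealization.congr {g : Eucl (d + 1) → Set (ExtEucl d)} (hf : IsRealization P f)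
    (h : EqOn f g (P.extremePoints ℝ)) : IsRealization P g where
  isBall x hx := h hx ▸ hf.isBall x hx
  injOn := hf.injOn.congr h
  tangent x hx y hy hxy he := h hx ▸ h hy ▸ hf.tangent x hx y hy hxy he

end Realization

end Apollonian


open Apollonian
theorem theorem4p1 (d : ℕ) (hd : 2 ≤ d) (P : Set (Eucl (d + 1))) (hP : IsStackedPolytope P) :
    (∀ S : Set (Set (ExtEucl d)), IsBallPacking S →
      Nonempty (polytopeGraph P ≃g tangencyGraph S) → IsApollonian S) ∧
    (∀ S₁ S₂ : Set (Set (ExtEucl d)), IsBallPacking S₁ → IsBallPacking S₂ →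
      ∀ (f₁ : polytopeGraph P ≃g tangencyGraph S₁) (f₂ : polytopeGraph P ≃g tangencyGraph S₂),
        ∃ φ ∈ mobiusGroup d, ∀ v : P.extremePoints ℝ,
          φ '' (f₁ v : Set (ExtEucl d)) = (f₂ v : Set (ExtEucl d))) := by
  refine ⟨fun S hS ⟨f⟩ => ?_, fun S₁ S₂ hS₁ hS₂ f₁ f₂ => ?_⟩
  · have h := (isRealization_extendIso hS f).isApollonian hd hP
    rw [image_extendIso f] at h
    exact h hS
  · have h₁ := isRealization_extendIso hS₁ f₁
    have h₂ := isRealization_extendIso hS₂ f₂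
    obtain ⟨x₁, hx₁⟩ := h₁.exists_vectors
    obtain ⟨x₂, hx₂⟩ := h₂.exists_vectors
    obtain ⟨φ, Φ, hΦ, h⟩ := exists_lifts_of_isRealization hd hP (fun w hw => (hx₁ w hw).1)
      (fun w hw => (hx₂ w hw).1) (h₁.congr fun w hw => (hx₁ w hw).2)
      (h₂.congr fun w hw => (hx₂ w hw).2)
    refine ⟨φ, hΦ.mem, fun v => ?_⟩
    rw [← extendIso_apply f₁, ← extendIso_apply f₂, (hx₁ v v.2).2, (hx₂ v v.2).2, hΦ.image,
      h v v.2]
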